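/- Conventions. Let $\mathcal W$ be a von Neumann algebra, equipped with its weak-$*$ topology. For a unital (not necessarily selfadjoint) subalgebra $\mathcal X\subset\mathcal W$, a functional $\varphi\in\mathcal X^*$ is called absolutely continuous (relative to $\mathcal W$) if it extends to a weak-$*$ continuous linear functional on $\mathcal W$; the set of such functionals is denoted $\mathrm{AC}_{\mathcal W}(\mathcal X)$. The bidual $\mathcal X^{**}$ carries the Arens product and acts on $\mathcal X^*$ by $(\Lambda\varphi)(a)=\Lambda(\varphi a)$, where $(\varphi a)(b)=\varphi(ab)$; its identity is denoted $I$. If $\mathfrak T\subset\mathcal W$ is a unital $\mathrm C^*$-algebra, then $\mathfrak T^{**}$ is a von Neumann algebra, and for a unital subalgebra $\mathcal A\subset\mathfrak T$ the algebra $\mathcal A^{**}$ is regarded as a unital subalgebra of $\mathfrak T^{**}$ by $\Lambda\mapsto(\psi\mapsto\Lambda(\psi|_{\mathcal A}))$; projections in $\mathcal A^{**}$ and their order are understood in $\mathfrak T^{**}$. A Lebesgue projection of $\mathfrak T$ relative to $\mathcal W$ is a central projection $\mathfrak z\in\mathfrak T^{**}$ with $\mathrm{AC}_{\mathcal W}(\mathfrak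 T)=\mathfrak z\,\mathfrak T^*$. A projection in $\mathfrak T^{**}$ is open if it is the weak-$*$ limit of an increasing net of positive contractions in $\mathfrak T$. The inclusion $\mathcal A\subset\mathfrak T$ has the Gleason--Whitney property relative to $\mathcal W$ if, whenever $\varphi\in\mathrm{AC}_{\mathcal W}(\mathcal A)$ and $\psi\in\mathfrak T^*$ satisfies $\psi|_{\mathcal A}=\varphi$ and $\|\psi\|=\|\varphi\|$, then $\psi\in\mathrm{AC}_{\mathcal W}(\mathfrak T)$. A character is a nonzero multiplicative bounded linear functional. Theorem. (1) Let $\mathcal W$ be a von Neumann algebra, let $\mathfrak T\subset\mathcal W$ be a unital $\mathrm C^*$-algebra and let $\mathcal A\subset\mathfrak T$ be a unital subalgebra. Suppose that $\mathfrak T$ has an open Lebesgue projection $\mathfrak z$ relative to $\mathcal W$ and that the inclusion $\mathcal A\subset\mathfrak T$ has the Gleason--Whitney property relative to $\mathcal W$. Then for every absolutely continuous character $\chi$ on $\mathcal A$ there is a nonzero projection $p\in\mathcal A^{**}$ such that $p\le\mathfrak z$ and $p(\chi)=1$. (2) Let $\mathcal H$ be a Hilbert space and let $\mathfrak T\subset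 B(\mathcal H)$ be a unital $\mathrm C^*$-algebra containing all compact operators. Then $\mathfrak T$ has an open Lebesgue projection $\mathfrak z$ relative to $B(\mathcal H)$. If $\mathcal H$ is infinite-dimensional, then $\mathfrak z$ is non-trivial, that is, $\mathfrak z\ne0$ and $\mathfrak z\neq I$; moreover, whenever $\mathcal A\subset\mathfrak T$ is a unital subalgebra such that the inclusion $\mathcal A\subset\mathfrak T$ has the Gleason--Whitney property relative to $B(\mathcal H)$ and $\chi$ is an absolutely continuous character on $\mathcal A$, there is a projection $p\in\mathcal A^{**}$ with $p\neq0$, $p\ne I$, $p\le\mathfrak z$ and $p(\chi)=1$. In particular, if such an $\mathcal A$ admits an absolutely continuous character, then $\mathcal A^{**}$ contains a non-trivial projection. -/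

import Mathlib

open scoped InnerProductSpace Topology
open Filter

universe u

noncomputable section

/-! ### The weak-star topology of a von Neumann algebra -/

section VonNeumann

variable {H : Type u} [NormedAddCommGroup H] [InnerProductSpace ℂ H]

/-- The functional `x ↦ ∑ₙ ⟪ηₙ, x ξₙ⟫` on `B(H)` given by two square-summable sequences `ξ`, `η` of
vectors. These functionals are exactly the trace class functionals, so that they form the
predual of `B(H)`. -/
def normalFunctional (ξ η : lp (fun _ : ℕ => H) 2) (x : H →L[ℂ] H) : ℂ :=
  ∑' n, ⟪η n, x (ξ n)⟫_ℂ

/-- The series defining `normalFunctional` always converges. -/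
theorem summable_normalFunctional (ξ η : lp (fun _ : ℕ => H) 2) (x : H →L[ℂ] H) :
    Summable fun n => ⟪η n, x (ξ n)⟫_ℂ := by
  refine .of_norm_bounded (g := fun n => ‖x‖ * (‖η n‖ * ‖ξ n‖)) (Summable.mul_left _ ?_) fun n => ?_
  · exact (Real.summable_mul_of_Lp_Lq_of_nonneg (f := fun n => ‖η n‖) (g := fun n => ‖ξ n‖)
      Real.HolderConjugate.two_two (fun _ => norm_nonneg _) (fun _ => norm_nonneg _)
      (by simpa using (lp.memℓp η).summable (by simp))
      (by simpa using (lp.memℓp ξ).summable (by simp)))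
  · calc ‖⟪η n, x (ξ n)⟫_ℂ‖ ≤ ‖η n‖ * ‖x (ξ n)‖ := norm_inner_le_norm _ _
      _ ≤ ‖η n‖ * (‖x‖ * ‖ξ n‖) := by gcongr; exact x.le_opNorm _
      _ = ‖x‖ * (‖η n‖ * ‖ξ n‖) := by ring

variable (H) in
/-- The weak-star (that is, ultraweak) topology of `B(H)`: the coarsest topology for which all
functionals in the predual are continuous. -/
@[reducible] def ultraweakTopology : TopologicalSpace (H →L[ℂ] H) :=
  ⨅ p : lp (fun _ : ℕ => H) 2 × lp (fun _ : ℕ => H) 2,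
    TopologicalSpace.induced (normalFunctional p.1 p.2) inferInstance

variable [CompleteSpace H]

/-- The weak-star topology of a von Neumann algebra `W ⊆ B(H)` is the relative ultraweak
topology. -/
@[reducible] def weakStarTopology (W : VonNeumannAlgebra H) : TopologicalSpace W.toStarSubalgebra :=
  TopologicalSpace.induced Subtype.val (ultraweakTopology H)

/-- The von Neumann algebra `B(H)` of all bounded operators on `H`. -/
def allBounded (H : Type u) [NormedAddCommGroup H] [InnerProductSpace ℂ H] [CompleteSpace H] :
    VonNeumannAlgebra H where
  toStarSubalgebra := ⊤
  centralizer_centralizer' := Set.Subset.antisymm (Set.subset_univ _)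
    (Set.subset_centralizer_centralizer (S := (Set.univ : Set (H →L[ℂ] H))))

/-- A bounded functional `φ` on a subalgebra `X` of `W` (selfadjoint or not) is absolutely continuous
relative to `W` if some weak-star continuous linear functional on `W` extends it. -/
def IsAbsCont {S : Type*} [SetLike S (H →L[ℂ] H)] [SubringClass S (H →L[ℂ] H)]
    [SMulMemClass S ℂ (H →L[ℂ] H)] (W : VonNeumannAlgebra H) (X : S)
    (φ : StrongDual ℂ X) : Prop :=
  ∃ Φ : W.toStarSubalgebra →ₗ[ℂ] ℂ,
    Continuous[weakStarTopology W, inferInstance] Φ ∧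
      ∀ (x : X) (w : W.toStarSubalgebra), (w : H →L[ℂ] H) = x → Φ w = φ x

end VonNeumann

/-! ### The Arens product and the projections of a bidual -/

section Bidual

variable {A : Type*} [NormedRing A] [NormedAlgebra ℂ A]

/-- The functional `φ b`, that is `a ↦ φ (b * a)`. -/
def dualMul (φ : StrongDual ℂ A) (b : A) : StrongDual ℂ A :=
  φ.comp (ContinuousLinearMap.mul ℂ A b)

/-- The map `b ↦ φ b`, as a bounded linear map from `A` to its dual. -/
def dualMulL (φ : StrongDual ℂ A) : A →L[ℂ] StrongDual ℂ A :=
  (ContinuousLinearMap.compL ℂ A A ℂ φ).comp (ContinuousLinearMap.mul ℂ A)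

theorem dualMulL_apply (φ : StrongDual ℂ A) (b : A) : dualMulL φ b = dualMul φ b := rfl

theorem dualMul_apply (φ : StrongDual ℂ A) (b a : A) : dualMul φ b a = φ (b * a) := rfl

/-- The left action of the bidual on the dual: `(Λ φ)(a) = Λ (φ a)`. -/
def bidualSMul (Λ : StrongDual ℂ (StrongDual ℂ A)) (φ : StrongDual ℂ A) : StrongDual ℂ A :=
  Λ.comp (dualMulL φ)

theorem bidualSMul_apply (Λ : StrongDual ℂ (StrongDual ℂ A)) (φ : StrongDual ℂ A) (a : A) :
    bidualSMul Λ φ a = Λ (dualMul φ a) := rfl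

/-- The Arens product on the bidual: `(Λ Ξ)(φ) = Λ (Ξ φ)`. -/
def arens (Λ Ξ : StrongDual ℂ (StrongDual ℂ A)) : StrongDual ℂ (StrongDual ℂ A) :=
  Λ.comp <| (ContinuousLinearMap.compL ℂ A (StrongDual ℂ A) ℂ Ξ).comp <|
    ((ContinuousLinearMap.compL ℂ A (A →L[ℂ] A) (StrongDual ℂ A)).flip
      (ContinuousLinearMap.mul ℂ A)).comp (ContinuousLinearMap.compL ℂ A A ℂ)

theorem arens_apply (Λ Ξ : StrongDual ℂ (StrongDual ℂ A)) (φ : StrongDual ℂ A) :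
    arens Λ Ξ φ = Λ (bidualSMul Ξ φ) := rfl

/-- The identity of the bidual of a unital algebra: evaluation at the identity. -/
def bidualOne : StrongDual ℂ (StrongDual ℂ A) :=
  NormedSpace.inclusionInDoubleDual ℂ A 1

/-- Characters: nonzero multiplicative bounded functionals. -/
def IsCharacter (χ : StrongDual ℂ A) : Prop :=
  χ ≠ 0 ∧ ∀ a b, χ (a * b) = χ a * χ b

variable [StarRing A] [StarModule ℂ A] [ContinuousStar A]

/-- The involution of the dual: `φ⋆ a` is the conjugate of `φ (star a)`. -/
def dualStar (φ : StrongDual ℂ A) : StrongDual ℂ A :=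
  ((starL ℂ : ℂ ≃L⋆[ℂ] ℂ) : ℂ →L⋆[ℂ] ℂ).comp (φ.comp ((starL ℂ : A ≃L⋆[ℂ] A) : A →L⋆[ℂ] A))

theorem dualStar_apply (φ : StrongDual ℂ A) (a : A) : dualStar φ a = star (φ (star a)) := rfl

/-- Projections of the bidual: selfadjoint idempotents, where the adjoint of `Λ` is the map sending
`φ` to the conjugate of `Λ (φ⋆)`. -/
def IsBidualProjection (p : StrongDual ℂ (StrongDual ℂ A)) : Prop :=
  arens p p = p ∧ ∀ φ, star (p (dualStar φ)) = p φ

/-- The usual order `p ≤ q` on projections. -/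
def BidualProjectionLE (p q : StrongDual ℂ (StrongDual ℂ A)) : Prop :=
  arens p q = p ∧ arens q p = p

end Bidual

/-! ### Lebesgue projections and the Gleason–Whitney property -/

section GleasonWhitney

variable {H : Type u} [NormedAddCommGroup H] [InnerProductSpace ℂ H] [CompleteSpace H]

/-- `z` is the Lebesgue projection of the `C⋆`-algebra `T ⊆ W` relative to `W`: a central projection
of the bidual of `T` such that the absolutely continuous functionals are exactly those of the
form `z φ`. -/
def IsLebesgueProjection (W : VonNeumannAlgebra H) (T : StarSubalgebra ℂ (H →L[ℂ] H))
    (z : StrongDual ℂ (StrongDual ℂ T)) : Prop :=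
  IsBidualProjection z ∧ (∀ Λ, arens z Λ = arens Λ z) ∧
    {ψ : StrongDual ℂ T | IsAbsCont W T ψ} = Set.range (bidualSMul z)

/-- A projection of the bidual of `T` is open if it is the weak-star limit of an increasing net of
positive contractions of `T`. -/
def IsOpenProjection (T : StarSubalgebra ℂ (H →L[ℂ] H))
    (z : StrongDual ℂ (StrongDual ℂ T)) : Prop :=
  IsBidualProjection z ∧
    ∃ (ι : Type u) (_ : Preorder ι) (_ : IsDirectedOrder ι) (_ : Nonempty ι) (t : ι → T),
      (Monotone fun i => (t i : H →L[ℂ] H)) ∧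
      (∀ i, 0 ≤ (t i : H →L[ℂ] H) ∧ ‖t i‖ ≤ 1) ∧
      ∀ φ : StrongDual ℂ T, Tendsto (fun i => φ (t i)) atTop (𝓝 (z φ))

/-- The inclusion of `A` in `T`. -/
def inclL {A : Subalgebra ℂ (H →L[ℂ] H)} {T : StarSubalgebra ℂ (H →L[ℂ] H)}
    (h : A ≤ T.toSubalgebra) : A →L[ℂ] T where
  toFun a := ⟨a, h a.2⟩
  map_add' _ _ := rfl
  map_smul' _ _ := rfl
  cont := continuous_subtype_val.subtype_mk _

/-- The inclusion of the bidual of `A` in the bidual of `T`: `Λ` is sent to `ψ ↦ Λ (ψ|_A)`. -/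
def bidualIncl {A : Subalgebra ℂ (H →L[ℂ] H)} {T : StarSubalgebra ℂ (H →L[ℂ] H)}
    (h : A ≤ T.toSubalgebra) (Λ : StrongDual ℂ (StrongDual ℂ A)) :
    StrongDual ℂ (StrongDual ℂ T) :=
  Λ.comp ((ContinuousLinearMap.compL ℂ A T ℂ).flip (inclL h))

theorem bidualIncl_apply {A : Subalgebra ℂ (H →L[ℂ] H)} {T : StarSubalgebra ℂ (H →L[ℂ] H)}
    (h : A ≤ T.toSubalgebra) (Λ : StrongDual ℂ (StrongDual ℂ A)) (ψ : StrongDual ℂ T) :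
    bidualIncl h Λ ψ = Λ (ψ.comp (inclL h)) := rfl

/-- The inclusion `A ⊆ T` has the Gleason–Whitney property relative to `W`: every norm-preserving
extension to `T` of an absolutely continuous functional on `A` is absolutely continuous. -/
def HasGleasonWhitney (W : VonNeumannAlgebra H) {A : Subalgebra ℂ (H →L[ℂ] H)}
    {T : StarSubalgebra ℂ (H →L[ℂ] H)} (h : A ≤ T.toSubalgebra) : Prop :=
  ∀ φ : StrongDual ℂ A, IsAbsCont W A φ →
    ∀ ψ : StrongDual ℂ T, ψ.comp (inclL h) = φ → ‖ψ‖ = ‖φ‖ → IsAbsCont W T ψ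

end GleasonWhitney

end

/-!
The first part rests on an idempotent of the bidual of `A`. All contractive extensions `ψ` to `T`
of an absolutely continuous character `χ` are absolutely continuous by the Gleason–Whitney
property, so that `z` takes the value `1` at `ψ` (`lebesgueProjection_apply_extension`). As `z` is
the limit of an increasing net `t`, the Riesz extension theorem yields `a ∈ A` with `Re a ≤ t i`
and `χ a` as close to `1` as desired (`exists_re_le_of_forall_extension`). The elements
`exp (N (a - 1))`, replaced by powers of `1 + (a - 1) / m` since `A` need not be closed, are then
almost contractive with value almost `1` at `χ`. They are of size `exp (-N)` on the range of the central
projection `1 - z`, where `t i` vanishes (`exists_peaking`), so the functionals `φ - z φ` tend to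
zero on them (`tendsto_sub_bidualSMul_apply`). The elements `Λ` of the unit ball of the bidual of
`A` with `Λ χ = 1` that vanish on all `φ - z φ` therefore form a nonempty weak-star compact
semigroup, and the Ellis–Numakura lemma provides an idempotent `p` in it
(`exists_idempotent_of_tendsto`).

A contractive idempotent of the bidual of `T` is selfadjoint
(`isBidualProjection_of_norm_le_one`). No `C⋆`-structure on the bidual is needed for this: the
bidual acts on the Hilbert space of every representation (`bidualRep`), contractive idempotents on
Hilbert spaces are selfadjoint, and by the Jordan decomposition
(`exists_positive_sub_of_hermitian`) and the Gelfand–Naimark–Segal construction the vector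
functionals of representations span the dual.

For the second part, `z` is the limit of the orthogonal projections `e` onto finite-dimensional
subspaces. Every functional `φ` on `T` agrees on finite-rank operators with a normal functional
`ω` (`exists_normal_part`): for positive `φ` it is the trace against the positive operator `D`
that represents `φ` on operators of rank one, written with the square root of `D` in a Hilbert
basis. Hence `φ (x e)` converges to `ω x`, and `φ (e x)` converges to `ω x` uniformly on the unit
ball, so that the functional `z φ` is the restriction of `ω`, and `z` is central
(`exists_lebesgueProjection`). In infinite dimensions `z` is not the identity, because some
functional vanishes on the compact operators but not at `1`.
-/

noncomputable section

/-! ### Positive functionals span the dual of a `C⋆`-algebra -/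

section Jordan

open scoped ComplexOrder

variable {B : Type*} [CStarAlgebra B] [PartialOrder B] [StarOrderedRing B]

theorem norm_smul_one_sub_add_star_nonneg (x : B) :
    0 ≤ ((‖x‖ : ℝ) • (1 : B) - x) + star ((‖x‖ : ℝ) • (1 : B) - x) := by
  have h : IsSelfAdjoint (x + star x) := IsSelfAdjoint.add_star_self x
  have h1 := h.le_algebraMap_norm_self
  have h2 : algebraMap ℝ B ‖x + star x‖ ≤ algebraMap ℝ B (‖x‖ + ‖x‖) := by
    apply algebraMap_mono
    simpa using norm_add_le x (star x)
  have h3 := h1.trans h2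
  rw [Algebra.algebraMap_eq_smul_one, add_smul] at h3
  have : ((‖x‖ : ℝ) • (1 : B) - x) + star ((‖x‖ : ℝ) • (1 : B) - x)
      = (‖x‖ • (1 : B) + ‖x‖ • (1 : B)) - (x + star x) := by
    simp only [star_sub, star_smul, star_one, star_trivial]
    abel
  rw [this]
  exact sub_nonneg.2 h3

/-- A real functional that is nonnegative on the elements with nonnegative real part is the real
part of a positive functional of norm at most `g 1`. -/
theorem exists_complexification (g : B →ₗ[ℝ] ℝ) (hg : ∀ x, 0 ≤ x + star x → 0 ≤ g x) :
    ∃ ψ : StrongDual ℂ B, (∀ x, (ψ x).re = g x) ∧ ‖ψ‖ ≤ g 1 ∧ ∀ x, 0 ≤ x → 0 ≤ ψ x := by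
  have hle : ∀ x, g x ≤ g 1 * ‖x‖ := fun x => by
    have := hg _ (norm_smul_one_sub_add_star_nonneg x)
    rw [map_sub, map_smul, smul_eq_mul] at this
    linarith
  have hbd : ∀ x, ‖g x‖ ≤ g 1 * ‖x‖ := fun x => by
    rw [Real.norm_eq_abs, abs_le]
    have := hle (-x)
    rw [map_neg, norm_neg] at this
    exact ⟨by linarith, hle x⟩
  have h1 : 0 ≤ g 1 := hg 1 (by simpa using add_nonneg zero_le_one zero_le_one)
  let G : StrongDual ℝ B := g.mkContinuous (g 1) hbd
  have hre : ∀ x, ((G.extendRCLike (𝕜 := ℂ)) x).re = g x := fun x =>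
    StrongDual.re_extendRCLike_apply (𝕜 := ℂ) G x
  refine ⟨G.extendRCLike, hre, ?_, fun x hx => ?_⟩
  · rw [StrongDual.norm_extendRCLike]
    exact LinearMap.mkContinuous_norm_le _ h1 _
  · have him : ((G.extendRCLike (𝕜 := ℂ)) x).im = - g (Complex.I • x) :=
      StrongDual.im_extendRCLike_apply (𝕜 := ℂ) G x
    have hsa : star x = x := (IsSelfAdjoint.of_nonneg hx).star_eq
    have hI : ∀ c : ℝ, 0 ≤ g (c • Complex.I • x) := fun c => hg _ (by simp [hsa])
    have e1 := hI 1
    have e2 := hI (-1)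
    rw [map_smul, smul_eq_mul] at e1 e2
    rw [Complex.nonneg_iff, hre, him]
    exact ⟨hg x (by rw [hsa]; exact add_nonneg hx hx), by linarith⟩

/-- **Jordan decomposition** of a hermitian functional `φ`. On `B × B` the real functional
`(x + t, -x + t) ↦ Re (φ x) + t ‖φ‖` is nonnegative on the pairs with nonnegative real parts, since
these satisfy `‖x + star x‖ ≤ 2 t`. A positive extension to `B × B`, restricted to the two
coordinates, gives two positive functionals with difference `φ`. -/
theorem exists_positive_sub_of_hermitian (φ : StrongDual ℂ B)
    (hφ : ∀ x, φ (star x) = star (φ x)) :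
    ∃ ψ₁ ψ₂ : StrongDual ℂ B, (∀ x, 0 ≤ x → 0 ≤ ψ₁ x) ∧ (∀ x, 0 ≤ x → 0 ≤ ψ₂ x) ∧
      φ = ψ₁ - ψ₂ := by
  -- in the zero algebra `t` is not determined by `x + t`
  rcases subsingleton_or_nontrivial B with hB | hB
  · refine ⟨0, 0, by simp, by simp, ?_⟩
    ext x
    simp [Subsingleton.elim x 0]
  let C : PointedCone ℝ (B × B) :=
    { carrier := {p | 0 ≤ p.1 + star p.1 ∧ 0 ≤ p.2 + star p.2}
      add_mem' := by
        rintro ⟨a, b⟩ ⟨c, d⟩ ⟨h1, h2⟩ ⟨h3, h4⟩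
        simp only [Set.mem_ofPred_eq, Prod.mk_add_mk, star_add] at *
        exact ⟨by simpa [add_add_add_comm] using add_nonneg h1 h3,
          by simpa [add_add_add_comm] using add_nonneg h2 h4⟩
      zero_mem' := by simp
      smul_mem' := by
        rintro ⟨c, hc⟩ ⟨a, b⟩ ⟨h1, h2⟩
        have key : ∀ a : B, 0 ≤ a + star a → 0 ≤ c • a + star (c • a) := fun a ha => by
          rw [star_smul, star_trivial, ← smul_add]
          exact smul_nonneg hc ha
        exact ⟨key a h1, key b h2⟩ }
  let j : (B × ℝ) →ₗ[ℝ] B × B :=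
    { toFun := fun p => (p.1 + p.2 • (1 : B), -p.1 + p.2 • (1 : B))
      map_add' := fun p q => by
        ext <;> simp only [Prod.fst_add, Prod.snd_add, add_smul] <;> abel
      map_smul' := fun c p => by
        ext <;> simp [mul_smul] }
  have hj : Function.Injective j := by
    rw [← LinearMap.ker_eq_bot, LinearMap.ker_eq_bot']
    rintro ⟨x, t⟩ h
    obtain ⟨h1, h2⟩ := Prod.ext_iff.1 h
    change x + t • (1 : B) = 0 at h1
    change -x + t • (1 : B) = 0 at h2
    have h3 : (2 * t) • (1 : B) = 0 := by
      rw [two_mul, add_smul]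
      calc _ = (x + t • (1 : B)) + (-x + t • (1 : B)) := by abel
        _ = 0 := by rw [h1, h2, add_zero]
    have ht : t = 0 := by simpa using h3
    subst ht
    simpa using h1
  let e := LinearEquiv.ofInjective j hj
  let f₀ : (B × ℝ) →ₗ[ℝ] ℝ :=
    { toFun := fun p => (φ p.1).re + p.2 * ‖φ‖
      map_add' := fun p q => by simp; ring
      map_smul' := fun c p => by simp; ring }
  let f : (B × B) →ₗ.[ℝ] ℝ := ⟨LinearMap.range j, f₀ ∘ₗ e.symm.toLinearMap⟩
  have hf : ∀ (p : f.domain) x t, (p : B × B) = j (x, t) → f p = (φ x).re + t * ‖φ‖ := by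
    intro p x t h
    change f₀ (e.symm p) = _
    have : e.symm p = (x, t) := by
      rw [LinearEquiv.symm_apply_eq]
      exact Subtype.ext h
    rw [this]
    rfl
  obtain ⟨g, hg1, hg2⟩ := riesz_extension C f (by
    rintro ⟨_, ⟨⟨x, t⟩, rfl⟩⟩ ⟨h1, h2⟩
    rw [hf _ x t rfl]
    change 0 ≤ (x + t • (1 : B)) + star (x + t • (1 : B)) at h1
    change 0 ≤ (-x + t • (1 : B)) + star (-x + t • (1 : B)) at h2
    have hs : IsSelfAdjoint (x + star x) := IsSelfAdjoint.add_star_self x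
    have hn : ‖x + star x‖ ≤ 2 * t := by
      have ht : algebraMap ℝ B (2 * t) = t • (1 : B) + t • (1 : B) := by
        rw [Algebra.algebraMap_eq_smul_one, two_mul, add_smul]
      have a1 : -(algebraMap ℝ B (2 * t)) ≤ x + star x := by
        rw [ht, neg_le_iff_add_nonneg]
        convert h1 using 1
        simp only [star_add, star_smul, star_one, star_trivial]
        abel
      have a2 : x + star x ≤ algebraMap ℝ B (2 * t) := by
        rw [ht, ← sub_nonneg]
        convert h2 using 1
        simp only [star_add, star_neg, star_smul, star_one, star_trivial]
        abel
      rw [neg_eq_neg_one_mul, ← map_one (algebraMap ℝ B), ← map_neg, ← map_mul,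
        algebraMap_le_iff_le_spectrum hs] at a1
      rw [le_algebraMap_iff_spectrum_le hs] at a2
      rcases CStarAlgebra.norm_or_neg_norm_mem_spectrum hs with h | h
      · exact a2 _ h
      · linarith [a1 _ h]
    have h3 : (φ (x + star x)).re = 2 * (φ x).re := by
      rw [map_add, hφ]; simp; ring
    have h4 : -(φ (x + star x)).re ≤ ‖φ‖ * (2 * t) :=
      calc -(φ (x + star x)).re ≤ ‖φ (x + star x)‖ :=
          (neg_le_abs _).trans (Complex.abs_re_le_norm _)
        _ ≤ ‖φ‖ * ‖x + star x‖ := φ.le_opNorm _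
        _ ≤ _ := by gcongr
    rw [h3] at h4
    linarith)
    (by
    rintro ⟨a, b⟩
    refine ⟨⟨j (0, max ‖a‖ ‖b‖), ⟨_, rfl⟩⟩, ?_⟩
    have key : ∀ (a : B) (t : ℝ), ‖a‖ ≤ t → 0 ≤ (t • (1 : B) + a) + star (t • (1 : B) + a) := by
      intro a t hat
      have h1 := norm_smul_one_sub_add_star_nonneg (-a)
      rw [norm_neg, sub_neg_eq_add] at h1
      have h2 : (0 : B) ≤ (t - ‖a‖) • (1 : B) := smul_nonneg (sub_nonneg.2 hat) zero_le_one
      have h3 := add_nonneg h1 (add_nonneg h2 h2)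
      convert h3 using 1
      simp only [star_add, star_smul, star_one, star_trivial, sub_smul]
      abel
    constructor
    · simpa [j] using key a _ (le_max_left _ _)
    · simpa [j] using key b _ (le_max_right _ _))
  obtain ⟨ψ₁, h1, -, p1⟩ := exists_complexification (g ∘ₗ LinearMap.inl ℝ B B)
    fun x hx => hg2 _ ⟨by simpa using hx, by simp⟩
  obtain ⟨ψ₂, h2, -, p2⟩ := exists_complexification (g ∘ₗ LinearMap.inr ℝ B B)
    fun x hx => hg2 _ ⟨by simp, by simpa using hx⟩
  refine ⟨ψ₁, ψ₂, p1, p2, ?_⟩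
  have hre : ∀ x, (φ x).re = ((ψ₁ - ψ₂) x).re := fun x => by
    have e1 : g (x, -x) = (φ x).re := by
      have := hg1 ⟨j (x, 0), ⟨_, rfl⟩⟩
      rw [hf _ x 0 rfl] at this
      simpa [j] using this
    have e2 : g (x, -x) = g (x, 0) - g (0, x) := by
      rw [← map_sub]; simp
    rw [sub_apply, Complex.sub_re, h1, h2, ← e1, e2]
    rfl
  ext x
  refine Complex.ext (hre x) ?_
  have := hre (Complex.I • x)
  simp only [map_smul, smul_eq_mul, Complex.I_mul_re] at this
  linarith

/-- The positive functionals span the dual, stated as an induction principle. -/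
theorem dual_induction {P : StrongDual ℂ B → Prop} (add : ∀ φ ψ, P φ → P ψ → P (φ + ψ))
    (smul : ∀ (c : ℂ) φ, P φ → P (c • φ))
    (pos : ∀ ψ : StrongDual ℂ B, (∀ x, 0 ≤ x → 0 ≤ ψ x) → P ψ) (φ : StrongDual ℂ B) : P φ := by
  have herm : ∀ φ : StrongDual ℂ B, (∀ x, φ (star x) = star (φ x)) → P φ := fun φ hφ => by
    obtain ⟨ψ₁, ψ₂, h1, h2, rfl⟩ := exists_positive_sub_of_hermitian φ hφ
    have := add _ _ (pos ψ₁ h1) (smul (-1) _ (pos ψ₂ h2))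
    convert this using 1
    ext x
    simp [sub_eq_add_neg]
  have h1 := herm (φ + dualStar φ) fun x => by simp [dualStar_apply, add_comm]
  have h2 := herm (Complex.I • (φ - dualStar φ)) fun x => by
    simp [dualStar_apply]
    ring
  have := add _ _ (smul (1 / 2) _ h1) (smul (-Complex.I / 2) _ h2)
  convert this using 1
  ext x
  simp only [add_apply, smul_apply, smul_eq_mul,
    sub_apply]
  linear_combination ((φ x - dualStar φ x) / 2) * Complex.I_sq

theorem exists_vector_of_positive {B : Type u} [CStarAlgebra B] [PartialOrder B] [StarOrderedRing B]
    (ψ : StrongDual ℂ B) (hψ : ∀ x, 0 ≤ x → 0 ≤ ψ x) :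
    ∃ (K : Type u) (_ : NormedAddCommGroup K) (_ : InnerProductSpace ℂ K) (_ : CompleteSpace K)
      (π : B →⋆ₐ[ℂ] (K →L[ℂ] K)) (ξ : K), ∀ x, ψ x = ⟪ξ, π x ξ⟫_ℂ := by
  let f : B →ₚ[ℂ] ℂ := PositiveLinearMap.mk₀ ψ.toLinearMap hψ
  refine ⟨f.GNS, inferInstance, inferInstance, inferInstance, f.gnsStarAlgHom,
    ((f.toPreGNS 1 : f.PreGNS) : f.GNS), fun x => ?_⟩
  have : f.gnsStarAlgHom x ((f.toPreGNS 1 : f.PreGNS) : f.GNS) =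
      f.leftMulMapPreGNS x (f.toPreGNS 1) := f.gnsNonUnitalStarAlgHom_apply_coe
  rw [this, UniformSpace.Completion.inner_coe, PositiveLinearMap.preGNS_inner_def]
  have hx : star (f.ofPreGNS (f.toPreGNS 1)) *
      f.ofPreGNS (f.leftMulMapPreGNS x (f.toPreGNS 1)) = x := by
    simp
  rw [hx]
  rfl

end Jordan

/-! ### Representations of the bidual -/

/-- A contractive idempotent `P` on a Hilbert space satisfies `P⋆ P = P`, so that it is selfadjoint:
`‖P ξ - P⋆ P ξ‖² = ‖P⋆ P ξ‖² - ‖P ξ‖² ≤ 0`. -/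
theorem adjoint_apply_self_of_contractive_idempotent {K : Type*} [NormedAddCommGroup K]
    [InnerProductSpace ℂ K] [CompleteSpace K] (P : K →L[ℂ] K) (hP : ∀ ξ, P (P ξ) = P ξ)
    (h1 : ‖P‖ ≤ 1) (ξ : K) : ContinuousLinearMap.adjoint P (P ξ) = P ξ := by
  set u := P ξ
  set v := ContinuousLinearMap.adjoint P u
  have hv : ‖v‖ ≤ ‖u‖ := by
    refine ((ContinuousLinearMap.adjoint P).le_of_opNorm_le (c := 1) ?_ u).trans (one_mul _).le
    rwa [LinearIsometryEquiv.norm_map]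
  have h : ‖u - v‖ ^ 2 = ‖v‖ ^ 2 - ‖u‖ ^ 2 := by
    rw [norm_sub_sq (𝕜 := ℂ), ContinuousLinearMap.adjoint_inner_right, hP,
      inner_self_eq_norm_sq]
    ring
  have h2 : ‖u - v‖ ^ 2 ≤ 0 := by
    rw [h]; nlinarith [norm_nonneg v]
  have h3 : ‖u - v‖ = 0 := by nlinarith [norm_nonneg (u - v)]
  rw [norm_sub_eq_zero_iff] at h3
  exact h3.symm

section Representation

variable {A : Type*} [NormedRing A] [NormedAlgebra ℂ A]

theorem bidualSMul_bidualSMul (Λ Ξ : StrongDual ℂ (StrongDual ℂ A)) (φ : StrongDual ℂ A) :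
    bidualSMul Λ (bidualSMul Ξ φ) = bidualSMul (arens Λ Ξ) φ := by
  ext a
  rw [bidualSMul_apply, bidualSMul_apply, arens_apply]
  congr 1
  ext b
  rw [dualMul_apply, bidualSMul_apply, bidualSMul_apply]
  congr 1
  ext c
  simp only [dualMul_apply, mul_assoc]

theorem arens_assoc (Λ Ξ Θ : StrongDual ℂ (StrongDual ℂ A)) :
    arens (arens Λ Ξ) Θ = arens Λ (arens Ξ Θ) := by
  ext φ
  rw [arens_apply, arens_apply, arens_apply, bidualSMul_bidualSMul]

theorem bidualSMul_add (Λ : StrongDual ℂ (StrongDual ℂ A)) (φ ψ : StrongDual ℂ A) :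
    bidualSMul Λ (φ + ψ) = bidualSMul Λ φ + bidualSMul Λ ψ := by
  ext x
  have : dualMul (φ + ψ) x = dualMul φ x + dualMul ψ x := rfl
  rw [bidualSMul_apply, this, map_add]
  rfl

theorem bidualSMul_smul (Λ : StrongDual ℂ (StrongDual ℂ A)) (c : ℂ) (φ : StrongDual ℂ A) :
    bidualSMul Λ (c • φ) = c • bidualSMul Λ φ := by
  ext x
  have : dualMul (c • φ) x = c • dualMul φ x := rfl
  rw [bidualSMul_apply, this, map_smul]
  rfl

theorem bidualSMul_apply_one (Λ : StrongDual ℂ (StrongDual ℂ A)) (φ : StrongDual ℂ A) :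
    bidualSMul Λ φ 1 = Λ φ := by
  have h : dualMul φ 1 = φ := by
    ext x
    rw [dualMul_apply, one_mul]
  rw [bidualSMul_apply, h]

theorem bidualOne_arens (Λ : StrongDual ℂ (StrongDual ℂ A)) : arens bidualOne Λ = Λ := by
  ext φ
  exact bidualSMul_apply_one Λ φ

theorem norm_dualMul_le (φ : StrongDual ℂ A) (b : A) : ‖dualMul φ b‖ ≤ ‖φ‖ * ‖b‖ :=
  (ContinuousLinearMap.opNorm_comp_le _ _).trans <| by
    gcongr
    exact ContinuousLinearMap.opNorm_mul_apply_le ℂ A b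

theorem norm_bidualSMul_le (Λ : StrongDual ℂ (StrongDual ℂ A)) (φ : StrongDual ℂ A) :
    ‖bidualSMul Λ φ‖ ≤ ‖Λ‖ * ‖φ‖ :=
  ContinuousLinearMap.opNorm_le_bound _ (by positivity) fun a =>
    calc ‖Λ (dualMul φ a)‖ ≤ ‖Λ‖ * ‖dualMul φ a‖ := Λ.le_opNorm _
      _ ≤ ‖Λ‖ * (‖φ‖ * ‖a‖) := by gcongr; exact norm_dualMul_le φ a
      _ = ‖Λ‖ * ‖φ‖ * ‖a‖ := by ring

variable [StarRing A] {K : Type*} [NormedAddCommGroup K] [InnerProductSpace ℂ K] [CompleteSpace K]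
  {π : A →⋆ₐ[ℂ] (K →L[ℂ] K)} (hπ : ∀ x, ‖π x‖ ≤ ‖x‖)

/-- The functional `x ↦ ⟪η, π x ξ⟫` attached to a contractive representation `π`. -/
def vectorFunctional (η ξ : K) : StrongDual ℂ A :=
  LinearMap.mkContinuous
    { toFun := fun x => ⟪η, π x ξ⟫_ℂ
      map_add' := fun x y => by simp
      map_smul' := fun c x => by simp } (‖η‖ * ‖ξ‖) fun x =>
    calc ‖⟪η, π x ξ⟫_ℂ‖ ≤ ‖η‖ * ‖π x ξ‖ := norm_inner_le_norm _ _
      _ ≤ ‖η‖ * (‖x‖ * ‖ξ‖) := by gcongr; exact (π x).le_of_opNorm_le (hπ x) ξ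
      _ = ‖η‖ * ‖ξ‖ * ‖x‖ := by ring

@[simp]
theorem vectorFunctional_apply (η ξ : K) (x : A) : vectorFunctional hπ η ξ x = ⟪η, π x ξ⟫_ℂ := rfl

theorem norm_vectorFunctional_le (η ξ : K) : ‖vectorFunctional hπ η ξ‖ ≤ ‖η‖ * ‖ξ‖ :=
  LinearMap.mkContinuous_norm_le _ (by positivity) _

/-- The sesquilinear form `(η, ξ) ↦ Λ (x ↦ ⟪η, π x ξ⟫)`. -/
def bidualForm (Λ : StrongDual ℂ (StrongDual ℂ A)) : K →L⋆[ℂ] K →L[ℂ] ℂ :=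
  LinearMap.mkContinuous₂
    (LinearMap.mk₂'ₛₗ (starRingEnd ℂ) (RingHom.id ℂ) (fun η ξ => Λ (vectorFunctional hπ η ξ))
      (fun η₁ η₂ ξ => by rw [← map_add]; congr 1; ext x; simp)
      (fun c η ξ => by rw [← map_smul]; congr 1; ext x; simp [mul_comm])
      (fun η ξ₁ ξ₂ => by rw [← map_add]; congr 1; ext x; simp)
      (fun c η ξ => by rw [← map_smul]; congr 1; ext x; simp)) ‖Λ‖ fun η ξ =>
    calc ‖Λ (vectorFunctional hπ η ξ)‖ ≤ ‖Λ‖ * ‖vectorFunctional hπ η ξ‖ := Λ.le_opNorm _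
      _ ≤ ‖Λ‖ * (‖η‖ * ‖ξ‖) := by gcongr; exact norm_vectorFunctional_le hπ η ξ
      _ = ‖Λ‖ * ‖η‖ * ‖ξ‖ := by ring

/-- The extension of a contractive representation `π` of `A` to the bidual of `A`, given by
`⟪η, π'' Λ ξ⟫ = Λ (x ↦ ⟪η, π x ξ⟫)`. -/
def bidualRep (Λ : StrongDual ℂ (StrongDual ℂ A)) : K →L[ℂ] K :=
  ContinuousLinearMap.adjoint (InnerProductSpace.continuousLinearMapOfBilin (bidualForm hπ Λ))

theorem inner_bidualRep (Λ : StrongDual ℂ (StrongDual ℂ A)) (η ξ : K) :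
    ⟪η, bidualRep hπ Λ ξ⟫_ℂ = Λ (vectorFunctional hπ η ξ) := by
  rw [bidualRep, ContinuousLinearMap.adjoint_inner_right,
    InnerProductSpace.continuousLinearMapOfBilin_apply]
  rfl

theorem norm_bidualRep_apply_le (Λ : StrongDual ℂ (StrongDual ℂ A)) (ξ : K) :
    ‖bidualRep hπ Λ ξ‖ ≤ ‖Λ‖ * ‖ξ‖ := by
  set v := bidualRep hπ Λ ξ with hv
  have h : ‖v‖ * ‖v‖ ≤ ‖Λ‖ * ‖ξ‖ * ‖v‖ :=
    calc ‖v‖ * ‖v‖ = ‖⟪v, v⟫_ℂ‖ := by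
          rw [inner_self_eq_norm_sq_to_K]; simp [sq]
      _ = ‖Λ (vectorFunctional hπ v ξ)‖ := by rw [← inner_bidualRep]
      _ ≤ ‖Λ‖ * (‖v‖ * ‖ξ‖) :=
        Λ.le_opNorm_of_le (norm_vectorFunctional_le hπ v ξ)
      _ = _ := by ring
  rcases (norm_nonneg v).eq_or_lt with h0 | h0
  · rw [← h0]; positivity
  · exact le_of_mul_le_mul_right h h0

theorem bidualSMul_vectorFunctional (Λ : StrongDual ℂ (StrongDual ℂ A)) (η ξ : K) :
    bidualSMul Λ (vectorFunctional hπ η ξ) = vectorFunctional hπ η (bidualRep hπ Λ ξ) := by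
  ext a
  have h : dualMul (vectorFunctional hπ η ξ) a = vectorFunctional hπ (π (star a) η) ξ := by
    ext b
    simp [dualMul_apply, map_star, ContinuousLinearMap.star_eq_adjoint,
      ContinuousLinearMap.adjoint_inner_left]
  rw [bidualSMul_apply, h, ← inner_bidualRep, vectorFunctional_apply, map_star,
    ContinuousLinearMap.star_eq_adjoint, ContinuousLinearMap.adjoint_inner_left]

theorem bidualRep_arens (Λ Ξ : StrongDual ℂ (StrongDual ℂ A)) (ξ : K) :
    bidualRep hπ (arens Λ Ξ) ξ = bidualRep hπ Λ (bidualRep hπ Ξ ξ) := by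
  refine ext_inner_left ℂ fun η => ?_
  rw [inner_bidualRep, inner_bidualRep, arens_apply, bidualSMul_vectorFunctional]

theorem bidualRep_inclusion (a : A) (ξ : K) :
    bidualRep hπ (NormedSpace.inclusionInDoubleDual ℂ A a) ξ = π a ξ := by
  refine ext_inner_left ℂ fun η => ?_
  rw [inner_bidualRep, NormedSpace.dual_def, vectorFunctional_apply]

end Representation

section Subalgebra

variable {H : Type u} [NormedAddCommGroup H] [InnerProductSpace ℂ H] [CompleteSpace H]

theorem norm_comp_subtype_le {K : Type*} [NormedAddCommGroup K] [InnerProductSpace ℂ K]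
    [CompleteSpace K] (T : StarSubalgebra ℂ (H →L[ℂ] H)) (π : (H →L[ℂ] H) →⋆ₐ[ℂ] (K →L[ℂ] K))
    (x : T) : ‖π.comp T.subtype x‖ ≤ ‖x‖ :=
  NonUnitalStarAlgHom.norm_apply_le π (x : H →L[ℂ] H)

theorem exists_extension_dual (T : StarSubalgebra ℂ (H →L[ℂ] H)) (φ : StrongDual ℂ T) :
    ∃ Φ : StrongDual ℂ (H →L[ℂ] H), (∀ x : T, Φ x = φ x) ∧ ‖Φ‖ = ‖φ‖ :=
  exists_extension_norm_eq (Subalgebra.toSubmodule T.toSubalgebra) φ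

/-- To prove a linear property of all functionals on `T ⊆ B(H)` it suffices to consider the vector
functionals of representations of `B(H)`. -/
theorem dual_induction_vectorFunctional (T : StarSubalgebra ℂ (H →L[ℂ] H))
    {P : StrongDual ℂ T → Prop} (add : ∀ φ ψ, P φ → P ψ → P (φ + ψ))
    (smul : ∀ (c : ℂ) φ, P φ → P (c • φ))
    (vec : ∀ (K : Type u) [NormedAddCommGroup K] [InnerProductSpace ℂ K] [CompleteSpace K]
      (π : (H →L[ℂ] H) →⋆ₐ[ℂ] (K →L[ℂ] K)) (ξ : K),
      P (vectorFunctional (norm_comp_subtype_le T π) ξ ξ)) (φ : StrongDual ℂ T) : P φ := by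
  let ι : T →L[ℂ] (H →L[ℂ] H) := (Subalgebra.toSubmodule T.toSubalgebra).subtypeL
  obtain ⟨Φ, hΦ, -⟩ := exists_extension_dual T φ
  have key : P (Φ.comp ι) := by
    refine dual_induction (P := fun Φ => P (Φ.comp ι)) (fun φ ψ h1 h2 => ?_) (fun c φ h => ?_)
      (fun ψ hψ => ?_) Φ
    · rw [ContinuousLinearMap.add_comp]; exact add _ _ h1 h2
    · rw [ContinuousLinearMap.smul_comp]; exact smul _ _ h
    · obtain ⟨K, _, _, _, π, ξ, h⟩ := exists_vector_of_positive ψ hψ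
      convert! vec K π ξ using 1
      ext x
      exact h x
  convert key using 1
  ext x
  exact (hΦ x).symm

/-- Contractive idempotents of the bidual are selfadjoint: their images in the representations of
the bidual are contractive idempotents on Hilbert spaces, and vector functionals span the dual. -/
theorem isBidualProjection_of_norm_le_one (T : StarSubalgebra ℂ (H →L[ℂ] H))
    (p : StrongDual ℂ (StrongDual ℂ T)) (hp : arens p p = p) (h1 : ‖p‖ ≤ 1) :
    IsBidualProjection p := by
  refine ⟨hp, fun φ => ?_⟩
  induction φ using dual_induction_vectorFunctional T with
  | add φ ψ h1 h2 =>
    have : dualStar (φ + ψ) = dualStar φ + dualStar ψ := by ext; simp [dualStar_apply]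
    rw [this, map_add, star_add, h1, h2, map_add]
  | smul c φ h =>
    have : dualStar (c • φ) = star c • dualStar φ := by ext; simp [dualStar_apply]
    rw [this, map_smul, smul_eq_mul, star_mul, star_star, h, map_smul, smul_eq_mul, mul_comm]
  | vec K π ξ =>
    have hπ := norm_comp_subtype_le T π
    have hstar : dualStar (vectorFunctional hπ ξ ξ) = vectorFunctional hπ ξ ξ := by
      ext x
      rw [dualStar_apply, vectorFunctional_apply, vectorFunctional_apply, map_star,
        ContinuousLinearMap.star_eq_adjoint, ContinuousLinearMap.adjoint_inner_right]
      exact inner_conj_symm _ _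
    have hP := adjoint_apply_self_of_contractive_idempotent (bidualRep hπ p)
      (fun ξ => by rw [← bidualRep_arens, hp])
      (ContinuousLinearMap.opNorm_le_bound _ zero_le_one fun ξ =>
        (norm_bidualRep_apply_le hπ p ξ).trans (by gcongr)) ξ
    rw [hstar, ← inner_bidualRep, ← hP, ContinuousLinearMap.adjoint_inner_right]
    exact inner_conj_symm _ _

variable {A : Subalgebra ℂ (H →L[ℂ] H)} {T : StarSubalgebra ℂ (H →L[ℂ] H)}

theorem bidualIncl_arens (h : A ≤ T.toSubalgebra) (Λ Ξ : StrongDual ℂ (StrongDual ℂ A)) :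
    bidualIncl h (arens Λ Ξ) = arens (bidualIncl h Λ) (bidualIncl h Ξ) := rfl

theorem bidualIncl_one (h : A ≤ T.toSubalgebra) : bidualIncl h bidualOne = bidualOne := rfl

theorem norm_bidualIncl_le (h : A ≤ T.toSubalgebra) (Λ : StrongDual ℂ (StrongDual ℂ A))
    (hΛ : ∀ φ, ‖Λ φ‖ ≤ ‖φ‖) : ‖bidualIncl h Λ‖ ≤ 1 :=
  ContinuousLinearMap.opNorm_le_bound _ zero_le_one fun ψ => by
    rw [one_mul]
    exact (hΛ _).trans <| ContinuousLinearMap.opNorm_le_bound _ (norm_nonneg _) fun a =>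
      ψ.le_opNorm (inclL h a)

end Subalgebra

/-! ### Idempotents in the bidual -/

section Idempotent

variable {A : Type*} [NormedRing A] [NormedAlgebra ℂ A]

/-- The elements `Λ` of the unit ball of the bidual with `Λ χ = 1` and `Λ = 0` on `N` form a
weak-star compact semigroup, in which the Arens product is continuous in the left variable. It is
nonempty because it contains the weak-star cluster points of the sequence `b`, so that the
Ellis–Numakura lemma gives an idempotent in it. -/
theorem exists_idempotent_of_tendsto (χ : StrongDual ℂ A) (hχ : ∀ a b, χ (a * b) = χ a * χ b)
    (N : Set (StrongDual ℂ A)) (hN : ∀ φ ∈ N, ∀ a, dualMul φ a ∈ N) (b : ℕ → A) (r : ℕ → ℝ)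
    (hr : Tendsto r atTop (𝓝 1)) (hb : ∀ᶠ n in atTop, ‖b n‖ ≤ r n)
    (hbχ : ∀ᶠ n in atTop, χ (b n) = 1)
    (hbN : ∀ φ ∈ N, Tendsto (fun n => φ (b n)) atTop (𝓝 0)) :
    ∃ p : StrongDual ℂ (StrongDual ℂ A), arens p p = p ∧ (∀ φ, ‖p φ‖ ≤ ‖φ‖) ∧ p χ = 1 ∧
      ∀ φ ∈ N, p φ = 0 := by
  let M := WeakDual ℂ (StrongDual ℂ A)
  let _ : Semigroup M :=
    { mul := fun Λ Ξ => StrongDual.toWeakDual (arens (WeakDual.toStrongDual Λ)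
        (WeakDual.toStrongDual Ξ))
      mul_assoc := fun Λ Ξ Θ => arens_assoc (A := A) (WeakDual.toStrongDual Λ)
        (WeakDual.toStrongDual Ξ) (WeakDual.toStrongDual Θ) }
  have hmul : ∀ (Λ Ξ : M) (φ : StrongDual ℂ A),
      (Λ * Ξ) φ = Λ (bidualSMul (WeakDual.toStrongDual Ξ) φ) := fun _ _ _ => rfl
  let S : Set M := {Λ | (∀ φ, ‖Λ φ‖ ≤ ‖φ‖) ∧ Λ χ = 1 ∧ ∀ φ ∈ N, Λ φ = 0}
  have hball : ∀ (Λ : M) (c : ℝ), 0 ≤ c → (∀ φ, ‖Λ φ‖ ≤ c * ‖φ‖) →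
      Λ ∈ WeakDual.toStrongDual ⁻¹' Metric.closedBall (0 : StrongDual ℂ (StrongDual ℂ A)) c :=
    fun Λ c hc h => by
      refine (mem_closedBall_zero_iff (E := StrongDual ℂ (StrongDual ℂ A))).2 ?_
      exact ContinuousLinearMap.opNorm_le_bound _ hc h
  have hScl : IsClosed S := by
    have e : S = (⋂ φ : StrongDual ℂ A, {Λ : M | ‖Λ φ‖ ≤ ‖φ‖}) ∩ ({Λ : M | Λ χ = 1} ∩
        ⋂ φ ∈ N, {Λ : M | Λ φ = 0}) := by
      ext Λ; simp [S]
    rw [e]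
    refine (isClosed_iInter fun φ => ?_).inter (IsClosed.inter ?_ (isClosed_biInter fun φ _ => ?_))
    · exact isClosed_le (WeakDual.eval_continuous φ).norm continuous_const
    · exact isClosed_eq (WeakDual.eval_continuous χ) continuous_const
    · exact isClosed_eq (WeakDual.eval_continuous φ) continuous_const
  have hScomp : IsCompact S :=
    (WeakDual.isCompact_closedBall (𝕜 := ℂ)
      (0 : StrongDual ℂ (StrongDual ℂ A)) 1).of_isClosed_subset hScl fun Λ hΛ =>
        hball Λ 1 zero_le_one fun φ => by simpa using hΛ.1 φ
  have hSne : S.Nonempty := by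
    let U : Ultrafilter ℕ := Filter.hyperfilter ℕ
    have hU : (U : Filter ℕ) ≤ atTop := Nat.hyperfilter_le_atTop
    let E : ℕ → M := fun n => StrongDual.toWeakDual (NormedSpace.inclusionInDoubleDual ℂ A (b n))
    have hE : ∀ n φ, E n φ = φ (b n) := fun _ _ => rfl
    have h2 : ∀ᶠ n in atTop, ‖b n‖ ≤ 2 := by
      filter_upwards [hb, hr.eventually (ge_mem_nhds (by norm_num : (1 : ℝ) < 2))] with n h1 h2
      exact h1.trans h2
    have hmem : ∀ᶠ n in (U : Filter ℕ), E n ∈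
        WeakDual.toStrongDual ⁻¹' Metric.closedBall (0 : StrongDual ℂ (StrongDual ℂ A)) 2 := by
      filter_upwards [hU h2] with n hn
      refine hball _ 2 zero_le_two fun φ => ?_
      rw [hE, mul_comm]
      exact φ.le_opNorm_of_le hn
    obtain ⟨Λ, -, hΛ⟩ := (WeakDual.isCompact_closedBall (𝕜 := ℂ)
      (0 : StrongDual ℂ (StrongDual ℂ A)) 2).ultrafilter_le_nhds (U.map E)
        (by rw [le_principal_iff]; exact hmem)
    have hlim : ∀ φ : StrongDual ℂ A, Tendsto (fun n => φ (b n)) U (𝓝 (Λ φ)) := fun φ =>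
      ((WeakDual.eval_continuous φ).tendsto Λ).comp (show Tendsto E U (𝓝 Λ) from hΛ)
    refine ⟨Λ, fun φ => ?_, ?_, fun φ hφ => ?_⟩
    · have : Tendsto (fun n => ‖φ‖ * r n) U (𝓝 (‖φ‖ * 1)) := (hr.mono_left hU).const_mul _
      rw [mul_one] at this
      refine le_of_tendsto_of_tendsto (hlim φ).norm this ?_
      filter_upwards [hU hb] with n hn
      exact φ.le_opNorm_of_le hn
    · refine tendsto_nhds_unique (hlim χ) (tendsto_const_nhds.congr' ?_)
      filter_upwards [hU hbχ] with n hn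
      exact hn.symm
    · exact tendsto_nhds_unique (hlim φ) ((hbN φ hφ).mono_left hU)
  have hSmul : ∀ᵉ (Λ ∈ S) (Ξ ∈ S), Λ * Ξ ∈ S := by
    rintro Λ ⟨h1, h2, h3⟩ Ξ ⟨k1, k2, k3⟩
    refine ⟨fun φ => ?_, ?_, fun φ hφ => ?_⟩
    · rw [hmul]
      refine (h1 _).trans ?_
      have : ‖WeakDual.toStrongDual Ξ‖ ≤ 1 :=
        ContinuousLinearMap.opNorm_le_bound _ zero_le_one fun φ => by simpa using k1 φ
      calc _ ≤ _ := norm_bidualSMul_le _ _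
        _ ≤ 1 * ‖φ‖ := by gcongr
        _ = ‖φ‖ := one_mul _
    · have : bidualSMul (WeakDual.toStrongDual Ξ) χ = χ := by
        ext a
        have e : dualMul χ a = χ a • χ := by
          ext x; simp [dualMul_apply, hχ]
        rw [bidualSMul_apply, e, map_smul, WeakDual.toStrongDual_apply, k2, smul_eq_mul, mul_one]
      rw [hmul, this, h2]
    · have : bidualSMul (WeakDual.toStrongDual Ξ) φ = 0 := by
        ext a
        exact k3 _ (hN φ hφ a)
      rw [hmul, this, map_zero]
  obtain ⟨p, ⟨h1, h2, h3⟩, hp⟩ := exists_idempotent_in_compact_subsemigroup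
    (fun Ξ : M => WeakDual.continuous_of_continuous_eval fun φ =>
      WeakDual.eval_continuous (bidualSMul (WeakDual.toStrongDual Ξ) φ)) S hSne hScomp hSmul
  exact ⟨WeakDual.toStrongDual p, hp, h1, h2, h3⟩

end Idempotent

/-! ### Elements dominated by an increasing net -/

section Dominated

variable {B : Type*} [CStarAlgebra B] [PartialOrder B] [StarOrderedRing B]

/-- If every contractive extension of `χ` exceeds `c` somewhere on the net `t`, then some `a ∈ A`
with `Re a ≤ t i` has `Re (χ a) > c`. Otherwise `Re χ` is nonnegative on the intersection of `A`
with the convex cone `C` of all `x` with `Re x ≥ k (c - t i)` for some `i` and `0 ≤ k`, and its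
extension by the Riesz theorem is the real part of a contractive extension `ψ` of `χ` with
`ψ (t i) ≤ c` for all `i`. -/
theorem exists_re_le_of_forall_extension (A : Subalgebra ℂ B) (χ : A →ₗ[ℂ] ℂ) (hχ : χ 1 = 1)
    {ι : Type*} [Preorder ι] [IsDirectedOrder ι] [Nonempty ι] (t : ι → B) (ht : Monotone t)
    (h0 : ∀ i, 0 ≤ t i) (c : ℝ)
    (h : ∀ ψ : StrongDual ℂ B, (∀ a : A, ψ a = χ a) → ‖ψ‖ ≤ 1 → ∃ i, c < (ψ (t i)).re) :
    ∃ (a : A) (i : ι), 0 ≤ (t i - a) + star (t i - (a : B)) ∧ c < (χ a).re := by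
  by_contra! hcon
  have pos_add : ∀ x y : B, 0 ≤ x + star x → 0 ≤ y + star y → 0 ≤ (x + y) + star (x + y) :=
    fun x y hx hy => by
      rw [star_add, add_add_add_comm]
      exact add_nonneg hx hy
  have pos_smul : ∀ (k : ℝ) (x : B), 0 ≤ k → 0 ≤ x + star x → 0 ≤ k • x + star (k • x) :=
    fun k x hk hx => by
      rw [star_smul, star_trivial, ← smul_add]
      exact smul_nonneg hk hx
  have pos_of : ∀ x : B, 0 ≤ x → 0 ≤ x + star x := fun x hx => add_nonneg hx (star_nonneg_iff.2 hx)
  let C : PointedCone ℝ B :=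
    { carrier := {x | ∃ (i : ι) (k : ℝ), 0 ≤ k ∧
        0 ≤ (x - k • (c • (1 : B) - t i)) + star (x - k • (c • (1 : B) - t i))}
      zero_mem' := ⟨Classical.arbitrary ι, 0, le_rfl, by simp⟩
      add_mem' := by
        rintro x y ⟨i, k, hk, hx⟩ ⟨j, l, hl, hy⟩
        obtain ⟨n, hin, hjn⟩ := exists_ge_ge i j
        refine ⟨n, k + l, add_nonneg hk hl, ?_⟩
        have e1 := pos_of _ (smul_nonneg hk (sub_nonneg.2 (ht hin)))
        have e2 := pos_of _ (smul_nonneg hl (sub_nonneg.2 (ht hjn)))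
        have e := pos_add _ _ (pos_add _ _ hx hy) (pos_add _ _ e1 e2)
        convert e using 2
        · module
        · congr 1; module
      smul_mem' := by
        rintro ⟨r, hr⟩ x ⟨i, k, hk, hx⟩
        refine ⟨i, r * k, mul_nonneg hr hk, ?_⟩
        have e := pos_smul r _ hr hx
        rw [smul_sub, smul_smul] at e
        exact e }
  let f : B →ₗ.[ℝ] ℝ := ⟨(Subalgebra.toSubmodule A).restrictScalars ℝ,
    { toFun := fun a => (χ a).re
      map_add' := fun a b => by
        have : χ (a + b) = χ a + χ b := map_add χ a b
        rw [this, Complex.add_re]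
      map_smul' := fun k a => by
        have : χ (k • a) = (k : ℂ) • χ a := χ.map_smul (k : ℂ) a
        rw [this]; simp }⟩
  have hf : ∀ a : A, ∀ h : (a : B) ∈ f.domain, f ⟨a, h⟩ = (χ a).re := fun _ _ => rfl
  obtain ⟨g, hg1, hg2⟩ := riesz_extension C f (by
    rintro ⟨a, ha⟩ ⟨i, k, hk, hx⟩
    have ha' : a ∈ A := ha
    rw [hf ⟨a, ha'⟩ ha]
    change 0 ≤ (a - k • (c • (1 : B) - t i)) + star (a - k • (c • (1 : B) - t i)) at hx
    rcases hk.eq_or_lt with rfl | hk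
    · -- all multiples `-r a` with `0 ≤ r` are dominated by `t i`
      rw [zero_smul, sub_zero] at hx
      by_contra! hneg
      have := hcon ((-((|c| + 1) / -(χ ⟨a, ha'⟩).re) : ℝ) • ⟨a, ha'⟩) i (by
        have e := pos_add _ _ (pos_of _ (h0 i)) (pos_smul ((|c| + 1) / -(χ ⟨a, ha'⟩).re) a
          (div_nonneg (by positivity) (by linarith)) hx)
        convert e using 2
        · simp
        · simp)
      have e : χ ((-((|c| + 1) / -(χ ⟨a, ha'⟩).re) : ℝ) • ⟨a, ha'⟩) =
          ((-((|c| + 1) / -(χ ⟨a, ha'⟩).re) : ℝ) : ℂ) • χ ⟨a, ha'⟩ := by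
        rw [← map_smul]; rfl
      rw [e, smul_eq_mul, Complex.re_ofReal_mul] at this
      have e2 : -((|c| + 1) / -(χ ⟨a, ha'⟩).re) * (χ ⟨a, ha'⟩).re = |c| + 1 := by
        have := hneg.ne
        field_simp
      linarith [le_abs_self c]
    · -- here `c - a / k` is dominated by `t i`
      have := hcon (c • 1 - k⁻¹ • ⟨a, ha'⟩) i (by
        have e := pos_smul k⁻¹ _ (inv_nonneg.2 hk.le) hx
        have e3 : t i - ((c • 1 - k⁻¹ • ⟨a, ha'⟩ : A) : B) =
            k⁻¹ • (a - k • (c • (1 : B) - t i)) := by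
          rw [smul_sub, smul_smul, inv_mul_cancel₀ hk.ne']
          change t i - (c • (1 : B) - k⁻¹ • a) = _
          module
        rw [e3]
        exact e)
      have e : χ (c • 1 - k⁻¹ • ⟨a, ha'⟩) = (c : ℂ) • χ 1 - ((k⁻¹ : ℝ) : ℂ) • χ ⟨a, ha'⟩ := by
        rw [← map_smul, ← map_smul, ← map_sub]; rfl
      rw [e, hχ, smul_eq_mul, smul_eq_mul, mul_one, Complex.sub_re, Complex.re_ofReal_mul,
        Complex.ofReal_re] at this
      have h3 : 0 ≤ k⁻¹ * (χ ⟨a, ha'⟩).re := by linarith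
      exact nonneg_of_mul_nonneg_right h3 (inv_pos.2 hk))
    (by
    intro y
    refine ⟨⟨‖y‖ • (1 : B), A.smul_mem A.one_mem (‖y‖ : ℂ)⟩, Classical.arbitrary ι, 0, le_rfl, ?_⟩
    have := norm_smul_one_sub_add_star_nonneg (-y)
    rw [norm_neg, sub_neg_eq_add] at this
    simpa using this)
  obtain ⟨ψ, hψ1, hψ2, -⟩ := exists_complexification g fun x hx =>
    hg2 x ⟨Classical.arbitrary ι, 0, le_rfl, by simpa using hx⟩
  have hgA : ∀ a : A, g a = (χ a).re := fun a => hg1 ⟨a, a.2⟩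
  obtain ⟨i, hi⟩ := h ψ (fun a => by
    refine Complex.ext ((hψ1 a).trans (hgA a)) ?_
    have h1 := (hψ1 _).trans (hgA (Complex.I • a))
    have h2 : ψ ((Complex.I • a : A) : B) = Complex.I * ψ a := by
      rw [← smul_eq_mul, ← map_smul]; rfl
    rw [h2, map_smul, smul_eq_mul, Complex.I_mul_re, Complex.I_mul_re] at h1
    linarith) (hψ2.trans (by
      have := hgA 1
      rw [hχ] at this
      exact this.le))
  have h1 := hg2 (c • (1 : B) - t i) ⟨i, 1, zero_le_one, by simp⟩
  have h2 := hgA 1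
  rw [hχ] at h2
  rw [map_sub, map_smul, smul_eq_mul, show g 1 = 1 from h2] at h1
  rw [hψ1] at hi
  linarith

end Dominated

/-! ### Peaking elements -/

section Peaking

/-- A numerical bound `Re ⟪ζ, X ζ⟫ ≤ r ‖ζ‖²` makes `1 + s (X - 1)` satisfy, up to second order in
`s`, the estimate by `exp (s (r - 1))` that holds for `exp (s (X - 1))`. -/
theorem norm_add_smul_sub_le {K : Type*} [NormedAddCommGroup K] [InnerProductSpace ℂ K]
    (X : K →L[ℂ] K) {M : ℝ} (hM : ‖X - 1‖ ≤ M) (r s : ℝ) (hs : 0 ≤ s) (ζ : K)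
    (h : (⟪ζ, X ζ⟫_ℂ).re ≤ r * ‖ζ‖ ^ 2) :
    ‖(1 + (s : ℂ) • (X - 1)) ζ‖ ≤ Real.exp (s * (r - 1) + s ^ 2 * M ^ 2 / 2) * ‖ζ‖ := by
  have h1 : ‖(X - 1) ζ‖ ≤ M * ‖ζ‖ := (X - 1).le_of_opNorm_le hM ζ
  have h2 : (⟪ζ, (X - 1) ζ⟫_ℂ).re ≤ (r - 1) * ‖ζ‖ ^ 2 := by
    have : (⟪ζ, ζ⟫_ℂ).re = ‖ζ‖ ^ 2 := inner_self_eq_norm_sq (𝕜 := ℂ) ζ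
    rw [sub_apply, inner_sub_right, Complex.sub_re, one_apply_eq_self, this]
    linarith
  have h3 : ‖(1 + (s : ℂ) • (X - 1)) ζ‖ ^ 2 =
      ‖ζ‖ ^ 2 + 2 * (s * (⟪ζ, (X - 1) ζ⟫_ℂ).re) + s ^ 2 * ‖(X - 1) ζ‖ ^ 2 := by
    have e : (1 + (s : ℂ) • (X - 1)) ζ = ζ + (s : ℂ) • (X - 1) ζ := rfl
    rw [e, norm_add_sq (𝕜 := ℂ), inner_smul_right, norm_smul, mul_pow, Complex.norm_real,
      Real.norm_eq_abs, sq_abs]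
    congr 3
    exact Complex.re_ofReal_mul _ _
  refine le_of_sq_le_sq ?_ (by positivity)
  have h4 : ‖(X - 1) ζ‖ ^ 2 ≤ M ^ 2 * ‖ζ‖ ^ 2 := by
    rw [← mul_pow]
    gcongr
  rw [h3, mul_pow, ← Real.exp_nat_mul]
  calc _ ≤ ‖ζ‖ ^ 2 + 2 * (s * ((r - 1) * ‖ζ‖ ^ 2)) + s ^ 2 * (M ^ 2 * ‖ζ‖ ^ 2) := by gcongr
    _ = (2 * (s * (r - 1) + s ^ 2 * M ^ 2 / 2) + 1) * ‖ζ‖ ^ 2 := by ring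
    _ ≤ _ := by
      gcongr
      exact Real.add_one_le_exp _

/-- Iteration of a norm estimate that holds on an invariant set of vectors. -/
theorem norm_pow_apply_le {K : Type*} [NormedAddCommGroup K] [NormedSpace ℂ K]
    (Y : K →L[ℂ] K) (V : Set K) (hV : ∀ ζ ∈ V, Y ζ ∈ V) {q : ℝ} (hq : 0 ≤ q)
    (hY : ∀ ζ ∈ V, ‖Y ζ‖ ≤ q * ‖ζ‖) (k : ℕ) : ∀ ζ ∈ V, ‖(Y ^ k) ζ‖ ≤ q ^ k * ‖ζ‖ := by
  induction k with
  | zero => simp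
  | succ k ih =>
    intro ζ hζ
    rw [pow_succ]
    calc ‖(Y ^ k) (Y ζ)‖ ≤ q ^ k * ‖Y ζ‖ := ih _ (hV ζ hζ)
      _ ≤ q ^ k * (q * ‖ζ‖) := by gcongr; exact hY ζ hζ
      _ = _ := by ring

variable {H : Type u} [NormedAddCommGroup H] [InnerProductSpace ℂ H] [CompleteSpace H]

/-- The relation `Re a ≤ t` passes to the numerical values in a representation. -/
theorem re_inner_le_of_nonneg {K : Type*} [NormedAddCommGroup K] [InnerProductSpace ℂ K]
    [CompleteSpace K] (π : (H →L[ℂ] H) →⋆ₐ[ℂ] (K →L[ℂ] K)) {t a : H →L[ℂ] H}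
    (h : 0 ≤ (t - a) + star (t - a)) (ζ : K) : (⟪ζ, π a ζ⟫_ℂ).re ≤ (⟪ζ, π t ζ⟫_ℂ).re := by
  have h1 : 0 ≤ π ((t - a) + star (t - a)) := map_nonneg π h
  rw [ContinuousLinearMap.nonneg_iff_isPositive] at h1
  have h2 : 0 ≤ (⟪ζ, (π ((t - a) + star (t - a))) ζ⟫_ℂ).re := h1.re_inner_nonneg_right ζ
  rw [map_add, map_star, map_sub, ContinuousLinearMap.star_eq_adjoint, add_apply,
    inner_add_right, ContinuousLinearMap.adjoint_inner_right, Complex.add_re] at h2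
  have h3 : (⟪(π t - π a) ζ, ζ⟫_ℂ).re = (⟪ζ, (π t - π a) ζ⟫_ℂ).re := inner_re_symm (𝕜 := ℂ) _ _
  rw [h3, sub_apply, inner_sub_right, Complex.sub_re] at h2
  linarith

/-- If `Re a ≤ t ≤ 1` and `χ a` is close to `1`, then a normalized power of `1 + (a - 1) / m`, which
approximates `exp (N (a - 1))`, is almost contractive, takes the value `1` at `χ` and is small
on the vectors on which `t` vanishes in a representation. -/
theorem exists_peaking (A : Subalgebra ℂ (H →L[ℂ] H)) (χ : A →ₗ[ℂ] ℂ) (hχ1 : χ 1 = 1)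
    (hχ : ∀ a b, χ (a * b) = χ a * χ b) (N : ℕ) (hN : 2 ≤ N) (a : A) (t : H →L[ℂ] H)
    (ht : t ≤ 1) (hat : 0 ≤ (t - a) + star (t - (a : H →L[ℂ] H)))
    (ha : 1 - 1 / (N : ℝ) ^ 2 < (χ a).re) :
    ∃ b : A, χ b = 1 ∧ ‖(b : H →L[ℂ] H)‖ ≤ Real.exp (1 / N) / (1 - 1 / N) ∧
      ∀ (K : Type u) [NormedAddCommGroup K] [InnerProductSpace ℂ K] [CompleteSpace K]
        (π : (H →L[ℂ] H) →⋆ₐ[ℂ] (K →L[ℂ] K)) (V : Submodule ℂ K),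
        (∀ ζ ∈ V, π a ζ ∈ V) → (∀ ζ ∈ V, (⟪ζ, π t ζ⟫_ℂ).re ≤ 0) →
        ∀ ζ ∈ V, ‖π b ζ‖ ≤ Real.exp (-N + 1 / N) / (1 - 1 / N) * ‖ζ‖ := by
  have hN' : (2 : ℝ) ≤ N := by exact_mod_cast hN
  set M : ℝ := ‖(a : H →L[ℂ] H) - 1‖ with hM
  -- the second-order error of `m * N` factors is at most `N * M ^ 2 / (2 * m) ≤ 1 / N`
  obtain ⟨m, hm⟩ := exists_nat_gt ((N : ℝ) ^ 2 * M ^ 2)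
  have hm0 : (0 : ℝ) < m := lt_of_le_of_lt (by positivity) hm
  set s : ℝ := 1 / m with hs
  have hs0 : 0 ≤ s := by positivity
  set k : ℕ := m * N with hk
  have hks : (k : ℝ) * s = N := by
    rw [hk, hs]; push_cast; field_simp
  have hq : ∀ r : ℝ, Real.exp (s * (r - 1) + s ^ 2 * M ^ 2 / 2) ^ k ≤
      Real.exp (N * (r - 1) + 1 / N) := fun r => by
    rw [← Real.exp_nat_mul, Real.exp_le_exp]
    have e : (k : ℝ) * (s * (r - 1) + s ^ 2 * M ^ 2 / 2) =
        N * (r - 1) + N * (s * M ^ 2 / 2) := by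
      rw [← hks]; ring
    rw [e]
    gcongr
    rw [hs, div_mul_eq_mul_div, one_mul, div_div, mul_div_assoc',
      div_le_div_iff₀ (by positivity) (by positivity)]
    nlinarith
  let c : A := 1 + (s : ℂ) • (a - 1)
  have hc : (c : H →L[ℂ] H) = 1 + (s : ℂ) • ((a : H →L[ℂ] H) - 1) := rfl
  have hχpow : ∀ n : ℕ, χ (c ^ n) = χ c ^ n := fun n => by
    induction n with
    | zero => simp [hχ1]
    | succ n ih => rw [pow_succ, hχ, ih, pow_succ]
  have hχc : 1 - 1 / (N : ℝ) ≤ ‖χ (c ^ k)‖ := by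
    have h1 : χ c = 1 + (s : ℂ) * (χ a - 1) := by
      simp [c, hχ1]
    have h2 : 1 + -(s * (1 / (N : ℝ) ^ 2)) ≤ ‖χ c‖ := by
      refine le_trans ?_ (Complex.re_le_norm _)
      rw [h1, Complex.add_re, Complex.re_ofReal_mul, Complex.sub_re, Complex.one_re]
      nlinarith
    have hm1 : (1 : ℝ) ≤ m := by
      have : 0 < m := by exact_mod_cast hm0
      exact_mod_cast this
    have h3 : s * (1 / (N : ℝ) ^ 2) ≤ 1 := by
      have e1 : s ≤ 1 := by rw [hs, div_le_one hm0]; exact hm1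
      have e2 : 1 / (N : ℝ) ^ 2 ≤ 1 := by
        rw [div_le_one (by positivity)]; nlinarith
      calc s * (1 / (N : ℝ) ^ 2) ≤ 1 * 1 := by gcongr
        _ = 1 := one_mul 1
    rw [hχpow, norm_pow]
    calc 1 - 1 / (N : ℝ) = 1 + k * -(s * (1 / (N : ℝ) ^ 2)) := by
          rw [mul_neg, ← mul_assoc, hks]; field_simp; ring
      _ ≤ (1 + -(s * (1 / (N : ℝ) ^ 2))) ^ k := one_add_mul_le_pow (by linarith) k
      _ ≤ _ := by gcongr; linarith
  have hN1 : 0 < 1 - 1 / (N : ℝ) := by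
    rw [sub_pos, div_lt_one (by linarith)]; linarith
  have hne : χ (c ^ k) ≠ 0 := norm_pos_iff.1 (hN1.trans_le hχc)
  -- this is applied with `r = 1` to all vectors of `H`, and with `r = 0` to `V`
  have hbd : ∀ {K : Type u} [NormedAddCommGroup K] [InnerProductSpace ℂ K] [CompleteSpace K]
      (π : (H →L[ℂ] H) →⋆ₐ[ℂ] (K →L[ℂ] K)) (V : Submodule ℂ K) (r : ℝ),
      (∀ ζ ∈ V, π a ζ ∈ V) → (∀ ζ ∈ V, (⟪ζ, π t ζ⟫_ℂ).re ≤ r * ‖ζ‖ ^ 2) →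
      ∀ ζ ∈ V, ‖π ((χ (c ^ k))⁻¹ • c ^ k : A) ζ‖ ≤
        Real.exp (N * (r - 1) + 1 / N) / (1 - 1 / N) * ‖ζ‖ := by
    intro K _ _ _ π V r hV hr ζ hζ
    have e1 : π c = 1 + (s : ℂ) • (π a - 1) := by
      rw [hc, map_add, map_one, map_smul, map_sub, map_one]
    have hVc : ∀ ζ ∈ V, π c ζ ∈ V := fun ζ hζ => by
      rw [e1]
      exact V.add_mem hζ (V.smul_mem _ (V.sub_mem (hV ζ hζ) hζ))
    have hMπ : ‖π a - 1‖ ≤ M := by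
      rw [← map_one π, ← map_sub]
      exact NonUnitalStarAlgHom.norm_apply_le π _
    have h1 := norm_pow_apply_le (π c) V hVc (Real.exp_pos _).le (fun ζ hζ => by
      rw [e1]
      exact norm_add_smul_sub_le (π a) hMπ r s hs0 ζ
        ((re_inner_le_of_nonneg π hat ζ).trans (hr ζ hζ))) k ζ hζ
    have e2 : π (((χ (c ^ k))⁻¹ • c ^ k : A) : H →L[ℂ] H) = (χ (c ^ k))⁻¹ • π c ^ k := by
      rw [← map_pow, ← map_smul]; rfl
    rw [e2]
    calc ‖((χ (c ^ k))⁻¹ • π c ^ k) ζ‖ = ‖χ (c ^ k)‖⁻¹ * ‖(π c ^ k) ζ‖ := by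
          rw [← norm_inv, ← norm_smul]; rfl
      _ ≤ (1 - 1 / (N : ℝ))⁻¹ * (Real.exp (N * (r - 1) + 1 / N) * ‖ζ‖) := by
          gcongr
          exact h1.trans (by gcongr; exact hq r)
      _ = _ := by rw [div_eq_mul_inv]; ring
  refine ⟨(χ (c ^ k))⁻¹ • c ^ k, ?_, ?_, ?_⟩
  · rw [map_smul, smul_eq_mul, inv_mul_cancel₀ hne]
  · refine ContinuousLinearMap.opNorm_le_bound _ (by positivity) fun ζ => ?_
    have := hbd (StarAlgHom.id ℂ (H →L[ℂ] H)) ⊤ 1 (by simp) (fun ζ _ => by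
      have h := re_inner_le_of_nonneg (StarAlgHom.id ℂ (H →L[ℂ] H)) (t := 1) (a := t)
        (add_nonneg (sub_nonneg.2 ht) (star_nonneg_iff.2 (sub_nonneg.2 ht))) ζ
      rw [one_mul]
      refine h.trans (le_of_eq ?_)
      exact inner_self_eq_norm_sq (𝕜 := ℂ) ζ) ζ trivial
    simpa using this
  · intro K _ _ _ π V hV h0 ζ hζ
    have := hbd π V 0 hV (fun ζ hζ => by simpa using h0 ζ hζ) ζ hζ
    convert this using 4
    ring

end Peaking

/-! ### Projections below an open Lebesgue projection -/

section OpenProjection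

variable {H : Type u} [NormedAddCommGroup H] [InnerProductSpace ℂ H] [CompleteSpace H]
  {A : Subalgebra ℂ (H →L[ℂ] H)} {T : StarSubalgebra ℂ (H →L[ℂ] H)}

/-- The Gleason–Whitney property forces every contractive extension `ψ` of an absolutely continuous
character to satisfy `z ψ = ψ`, so that `z` takes the value `1` at `ψ`. -/
theorem lebesgueProjection_apply_extension (W : VonNeumannAlgebra H) (hAT : A ≤ T.toSubalgebra)
    (z : StrongDual ℂ (StrongDual ℂ T)) (hz : IsLebesgueProjection W T z)
    (hGW : HasGleasonWhitney W hAT) (χ : StrongDual ℂ A) (hχ1 : χ 1 = 1) (hχac : IsAbsCont W A χ)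
    (ψ : StrongDual ℂ T) (hψ : ψ.comp (inclL hAT) = χ) (hψ1 : ‖ψ‖ ≤ 1) : z ψ = 1 := by
  have h1 : ψ 1 = 1 := by
    have := congrArg (fun φ : StrongDual ℂ A => φ 1) hψ
    exact this.trans hχ1
  have hχn : 1 ≤ ‖χ‖ := by
    have h := χ.le_opNorm 1
    rw [hχ1, norm_one] at h
    have h2 : ‖(1 : A)‖ ≤ 1 := ContinuousLinearMap.norm_id_le
    nlinarith [norm_nonneg χ]
  have hle : ‖χ‖ ≤ ‖ψ‖ := by
    rw [← hψ]
    exact ContinuousLinearMap.opNorm_le_bound _ (norm_nonneg _) fun a => ψ.le_opNorm (inclL hAT a)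
  have hac := hGW χ hχac ψ hψ (le_antisymm (hψ1.trans hχn) hle)
  have hmem : ψ ∈ Set.range (bidualSMul z) := by
    rw [← hz.2.2]; exact hac
  obtain ⟨φ, rfl⟩ := hmem
  rw [← bidualSMul_apply_one, bidualSMul_bidualSMul, hz.1.1]
  exact h1

/-- If the elements `b n` become small in every representation on the vectors on which the net `t`
vanishes, then the functionals `φ - z φ` vanish asymptotically along `b`. -/
theorem tendsto_sub_bidualSMul_apply (hAT : A ≤ T.toSubalgebra)
    {z : StrongDual ℂ (StrongDual ℂ T)} (hzz : arens z z = z) (hzc : ∀ Λ, arens z Λ = arens Λ z)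
    {ι : Type*} [Preorder ι] [IsDirectedOrder ι] [Nonempty ι] {t : ι → T}
    (htm : Monotone fun i => (t i : H →L[ℂ] H))
    (htz : ∀ φ : StrongDual ℂ T, Tendsto (fun i => φ (t i)) atTop (𝓝 (z φ)))
    {b : ℕ → A} {δ : ℕ → ℝ} (hδ : Tendsto δ atTop (𝓝 0))
    (hb : ∀ᶠ n in atTop, ∃ a : A, ∃ i,
      ∀ (K : Type u) [NormedAddCommGroup K] [InnerProductSpace ℂ K] [CompleteSpace K]
        (π : (H →L[ℂ] H) →⋆ₐ[ℂ] (K →L[ℂ] K)) (V : Submodule ℂ K),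
        (∀ ζ ∈ V, π a ζ ∈ V) → (∀ ζ ∈ V, (⟪ζ, π (t i) ζ⟫_ℂ).re ≤ 0) →
        ∀ ζ ∈ V, ‖π (b n) ζ‖ ≤ δ n * ‖ζ‖) (φ : StrongDual ℂ T) :
    Tendsto (fun n => (φ - bidualSMul z φ) (inclL hAT (b n))) atTop (𝓝 0) := by
  induction φ using dual_induction_vectorFunctional T with
  | add φ ψ h1 h2 =>
    have := h1.add h2
    rw [add_zero] at this
    refine this.congr fun n => ?_
    rw [bidualSMul_add]
    simp only [sub_apply, add_apply]
    ring
  | smul c φ h =>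
    have := h.const_mul c
    rw [mul_zero] at this
    refine this.congr fun n => ?_
    rw [bidualSMul_smul]
    simp only [sub_apply, smul_apply, smul_eq_mul]
    ring
  | vec K π ξ =>
    have hπ := norm_comp_subtype_le T π
    obtain ⟨Z, hZ⟩ : ∃ Z, Z = bidualRep hπ z := ⟨_, rfl⟩
    have hZZ : ∀ ζ, Z (Z ζ) = Z ζ := fun ζ => by rw [hZ, ← bidualRep_arens, hzz]
    have hcomm : ∀ (x : T) ζ, Z (π x ζ) = π x (Z ζ) := fun x ζ => by
      have h := congrArg (fun Λ => bidualRep hπ Λ ζ)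
        (hzc (NormedSpace.inclusionInDoubleDual ℂ T x))
      simp only [bidualRep_arens, bidualRep_inclusion] at h
      rw [hZ]
      exact h
    let V : Submodule ℂ K := LinearMap.ker Z.toLinearMap
    have hV : ∀ ζ, ζ ∈ V ↔ Z ζ = 0 := fun ζ => LinearMap.mem_ker
    have hVinv : ∀ a : A, ∀ ζ ∈ V, π a ζ ∈ V := fun a ζ hζ => by
      rw [hV] at hζ ⊢
      have := hcomm ⟨a, hAT a.2⟩ ζ
      rwa [hζ, map_zero] at this
    have hV0 : ∀ i, ∀ ζ ∈ V, (⟪ζ, π (t i) ζ⟫_ℂ).re ≤ 0 := fun i ζ hζ => by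
      have hlim : Tendsto (fun i => (⟪ζ, π (t i) ζ⟫_ℂ).re) atTop
          (𝓝 (z (vectorFunctional hπ ζ ζ)).re) :=
        (Complex.continuous_re.tendsto _).comp (htz (vectorFunctional hπ ζ ζ))
      rw [← inner_bidualRep, ← hZ, (hV ζ).1 hζ, inner_zero_right, Complex.zero_re] at hlim
      refine Monotone.ge_of_tendsto (fun i j hij => ?_) hlim i
      have hle := sub_nonneg.2 (htm hij)
      exact re_inner_le_of_nonneg π (add_nonneg hle (star_nonneg_iff.2 hle)) ζ
    have hξV : ξ - Z ξ ∈ V := by rw [hV, map_sub, hZZ, sub_self]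
    refine squeeze_zero_norm' (a := fun n : ℕ => ‖ξ‖ * (δ n * ‖ξ - Z ξ‖)) ?_ ?_
    · filter_upwards [hb] with n hn
      obtain ⟨a, i, h⟩ := hn
      have e : (vectorFunctional hπ ξ ξ - bidualSMul z (vectorFunctional hπ ξ ξ))
          (inclL hAT (b n)) = ⟪ξ, π (b n) (ξ - Z ξ)⟫_ℂ := by
        rw [bidualSMul_vectorFunctional, sub_apply, map_sub, inner_sub_right, hZ]
        rfl
      rw [e]
      refine (norm_inner_le_norm _ _).trans ?_
      gcongr
      exact h K π V (hVinv a) (hV0 i) _ hξV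
    · simpa using (hδ.mul_const ‖ξ - Z ξ‖).const_mul ‖ξ‖

/-- A contractive idempotent of the bidual of `A` that vanishes on all `φ - z φ` is a projection
below the central projection `z`. -/
theorem isBidualProjection_and_le_of_idempotent (hAT : A ≤ T.toSubalgebra)
    {z : StrongDual ℂ (StrongDual ℂ T)} (hzc : ∀ Λ, arens z Λ = arens Λ z)
    {p : StrongDual ℂ (StrongDual ℂ A)} (hpp : arens p p = p) (hp1 : ∀ φ, ‖p φ‖ ≤ ‖φ‖)
    (hp0 : ∀ φ : StrongDual ℂ T, p ((φ - bidualSMul z φ).comp (inclL hAT)) = 0) :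
    IsBidualProjection (bidualIncl hAT p) ∧ BidualProjectionLE (bidualIncl hAT p) z := by
  have hpz : arens (bidualIncl hAT p) z = bidualIncl hAT p := by
    ext φ
    have e : bidualIncl hAT p (φ - bidualSMul z φ) = 0 := hp0 φ
    rw [map_sub, sub_eq_zero] at e
    exact e.symm
  refine ⟨isBidualProjection_of_norm_le_one T _ ?_ (norm_bidualIncl_le hAT p hp1), hpz, ?_⟩
  · rw [← bidualIncl_arens, hpp]
  · rw [hzc, hpz]

/-- Below an open Lebesgue projection with the Gleason–Whitney property, every absolutely continuous
character is supported by a projection of the bidual of `A`. -/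
theorem exists_projection_le (W : VonNeumannAlgebra H) (hAT : A ≤ T.toSubalgebra)
    (z : StrongDual ℂ (StrongDual ℂ T)) (hz : IsLebesgueProjection W T z)
    (hzo : IsOpenProjection T z) (hGW : HasGleasonWhitney W hAT) (χ : StrongDual ℂ A)
    (hχ : IsCharacter χ) (hχac : IsAbsCont W A χ) :
    ∃ p : StrongDual ℂ (StrongDual ℂ A), p ≠ 0 ∧ IsBidualProjection (bidualIncl hAT p) ∧
      BidualProjectionLE (bidualIncl hAT p) z ∧ p χ = 1 := by
  obtain ⟨-, ι, _, _, _, t, htm, ht, htz⟩ := hzo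
  obtain ⟨hχ0, hχm⟩ := hχ
  have hχ1 : χ 1 = 1 := by
    by_contra hne
    refine hχ0 (ContinuousLinearMap.ext fun a => ?_)
    have h1 := hχm 1 1
    have h2 := hχm 1 a
    rw [one_mul] at h1 h2
    have h3 : χ 1 = 0 := by
      have : χ 1 * (χ 1 - 1) = 0 := by rw [mul_sub, ← h1, mul_one, sub_self]
      exact (mul_eq_zero.1 this).resolve_right (sub_ne_zero.2 hne)
    rw [h2, h3, zero_mul]; rfl
  have ht1 : ∀ i, (t i : H →L[ℂ] H) ≤ 1 := fun i =>
    (CStarAlgebra.norm_le_one_iff_of_nonneg (t i : H →L[ℂ] H) (ht i).1).1 (ht i).2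
  have hb : ∀ n : ℕ, ∃ b : A, 2 ≤ n → χ b = 1 ∧
      ‖(b : H →L[ℂ] H)‖ ≤ Real.exp (1 / n) / (1 - 1 / n) ∧
      ∃ a : A, ∃ i, ∀ (K : Type u) [NormedAddCommGroup K] [InnerProductSpace ℂ K] [CompleteSpace K]
        (π : (H →L[ℂ] H) →⋆ₐ[ℂ] (K →L[ℂ] K)) (V : Submodule ℂ K),
        (∀ ζ ∈ V, π a ζ ∈ V) → (∀ ζ ∈ V, (⟪ζ, π (t i) ζ⟫_ℂ).re ≤ 0) →
        ∀ ζ ∈ V, ‖π b ζ‖ ≤ Real.exp (-n + 1 / n) / (1 - 1 / n) * ‖ζ‖ := fun n => by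
    by_cases hn : 2 ≤ n
    swap
    · exact ⟨0, fun h => absurd h hn⟩
    obtain ⟨a, i, h1, h2⟩ := exists_re_le_of_forall_extension A χ.toLinearMap hχ1
      (fun i => (t i : H →L[ℂ] H)) htm (fun i => (ht i).1) (1 - 1 / (n : ℝ) ^ 2)
      fun ψ hψ hψ1 => by
        let ψT : StrongDual ℂ T := ψ.comp (Subalgebra.toSubmodule T.toSubalgebra).subtypeL
        have hzψ := lebesgueProjection_apply_extension W hAT z hz hGW χ hχ1 hχac ψT
          (ContinuousLinearMap.ext hψ)
          (ContinuousLinearMap.opNorm_le_bound _ zero_le_one fun x =>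
            ψ.le_of_opNorm_le hψ1 (x : H →L[ℂ] H))
        have hlim := (Complex.continuous_re.tendsto _).comp (htz ψT)
        rw [hzψ] at hlim
        have hn0 : 1 - 1 / (n : ℝ) ^ 2 < (1 : ℂ).re := by
          have : (0 : ℝ) < n := by exact_mod_cast (by omega : 0 < n)
          rw [Complex.one_re]
          have : 0 < 1 / (n : ℝ) ^ 2 := by positivity
          linarith
        exact (hlim.eventually_const_lt hn0).exists
    obtain ⟨b, hb1, hb2, hb3⟩ := exists_peaking A χ.toLinearMap hχ1 hχm n hn a (t i) (ht1 i) h1 h2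
    exact ⟨b, fun _ => ⟨hb1, hb2, a, i, hb3⟩⟩
  choose b hb using hb
  have hinv : Tendsto (fun n : ℕ => 1 / (n : ℝ)) atTop (𝓝 0) := tendsto_one_div_atTop_nhds_zero_nat
  have hr : Tendsto (fun n : ℕ => Real.exp (1 / n) / (1 - 1 / (n : ℝ))) atTop (𝓝 1) := by
    have := ((Real.continuous_exp.tendsto _).comp hinv).div (hinv.const_sub 1) (by norm_num)
    simpa [Function.comp_def, Pi.div_def] using this
  have hr' : Tendsto (fun n : ℕ => Real.exp (-n + 1 / n) / (1 - 1 / (n : ℝ))) atTop (𝓝 0) := by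
    have h1 : Tendsto (fun n : ℕ => -(n : ℝ) + 1 / n) atTop atBot :=
      (tendsto_neg_atTop_atBot.comp tendsto_natCast_atTop_atTop).atBot_add hinv
    have := (Real.tendsto_exp_atBot.comp h1).div (hinv.const_sub 1) (by norm_num)
    simpa [Function.comp_def, Pi.div_def] using this
  have hvan : ∀ φ : StrongDual ℂ T,
      Tendsto (fun n => (φ - bidualSMul z φ) (inclL hAT (b n))) atTop (𝓝 0) :=
    tendsto_sub_bidualSMul_apply hAT hz.1.1 hz.2.1 htm htz hr' <| by
      filter_upwards [eventually_ge_atTop 2] with n hn using (hb n hn).2.2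
  obtain ⟨p, hpp, hp1, hpχ, hp0⟩ := exists_idempotent_of_tendsto χ hχm
    (Set.range fun φ : StrongDual ℂ T => (φ - bidualSMul z φ).comp (inclL hAT))
    (by
      rintro _ ⟨φ, rfl⟩ a
      refine ⟨dualMul φ (inclL hAT a), ContinuousLinearMap.ext fun x => ?_⟩
      have e : dualMul (dualMul φ (inclL hAT a)) (inclL hAT x) = dualMul φ (inclL hAT (a * x)) := by
        ext y
        rw [dualMul_apply, dualMul_apply, dualMul_apply, ← mul_assoc]; rfl
      change dualMul φ (inclL hAT a) (inclL hAT x) -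
        z (dualMul (dualMul φ (inclL hAT a)) (inclL hAT x)) =
        φ (inclL hAT (a * x)) - z (dualMul φ (inclL hAT (a * x)))
      rw [e]; rfl)
    b _ hr
    (by filter_upwards [eventually_ge_atTop 2] with n hn using (hb n hn).2.1)
    (by filter_upwards [eventually_ge_atTop 2] with n hn using (hb n hn).1)
    (by rintro _ ⟨φ, rfl⟩; exact hvan φ)
  obtain ⟨h1, h2⟩ := isBidualProjection_and_le_of_idempotent hAT hz.2.1 hpp hp1 fun φ =>
    hp0 _ (Set.mem_range_self φ)
  refine ⟨p, fun h => ?_, h1, h2, hpχ⟩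
  rw [h] at hpχ
  exact zero_ne_one hpχ

end OpenProjection

/-! ### Normal functionals on `B(H)` -/

section Normal

open InnerProductSpace (rankOne)

theorem summable_norm_mul_norm {H : Type u} [NormedAddCommGroup H] (ξ η : lp (fun _ : ℕ => H) 2) :
    Summable fun n => ‖η n‖ * ‖ξ n‖ :=
  Real.summable_mul_of_Lp_Lq_of_nonneg (f := fun n => ‖η n‖) (g := fun n => ‖ξ n‖)
    Real.HolderConjugate.two_two (fun _ => norm_nonneg _) (fun _ => norm_nonneg _)
    (by simpa using (lp.memℓp η).summable (by simp))
    (by simpa using (lp.memℓp ξ).summable (by simp))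

variable {H : Type u} [NormedAddCommGroup H] [InnerProductSpace ℂ H]

/-- The functional `normalFunctional ξ η` as an element of the dual of `B(H)`. -/
def normalFunctionalL (ξ η : lp (fun _ : ℕ => H) 2) : StrongDual ℂ (H →L[ℂ] H) :=
  LinearMap.mkContinuous
    { toFun := normalFunctional ξ η
      map_add' := fun x y => by
        rw [normalFunctional, normalFunctional, normalFunctional,
          ← (summable_normalFunctional ξ η x).tsum_add (summable_normalFunctional ξ η y)]
        simp
      map_smul' := fun c x => by
        simp [normalFunctional, tsum_mul_left] }
    (∑' n, ‖η n‖ * ‖ξ n‖) fun x => by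
    rw [← tsum_mul_right]
    refine tsum_of_norm_bounded ((summable_norm_mul_norm ξ η).mul_right _).hasSum fun n => ?_
    calc ‖⟪η n, x (ξ n)⟫_ℂ‖ ≤ ‖η n‖ * ‖x (ξ n)‖ := norm_inner_le_norm _ _
      _ ≤ ‖η n‖ * (‖x‖ * ‖ξ n‖) := by gcongr; exact x.le_opNorm _
      _ = ‖η n‖ * ‖ξ n‖ * ‖x‖ := by ring

theorem normalFunctionalL_apply (ξ η : lp (fun _ : ℕ => H) 2) (x : H →L[ℂ] H) :
    normalFunctionalL ξ η x = ∑' n, ⟪η n, x (ξ n)⟫_ℂ := rfl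

theorem continuous_normalFunctionalL (ξ η : lp (fun _ : ℕ => H) 2) :
    Continuous[ultraweakTopology H, inferInstance] (normalFunctionalL ξ η) :=
  continuous_iff_le_induced.2 (iInf_le _ (ξ, η))

/-- Sums over an arbitrary index set of the vector functionals of a square-summable family are
normal functionals, because only countably many vectors are nonzero. -/
theorem exists_hasSum_normalFunctionalL {w : Type*} (ξ : w → H)
    (hξ : Summable fun α => ‖ξ α‖ ^ 2) :
    ∃ ζ : lp (fun _ : ℕ => H) 2, ∀ x : H →L[ℂ] H,
      HasSum (fun α => ⟪ξ α, x (ξ α)⟫_ℂ) (normalFunctionalL ζ ζ x) := by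
  set s : Set w := Function.support fun α => ‖ξ α‖ ^ 2 with hs
  have hsc : s.Countable := hξ.countable_support
  have : Countable s := hsc.to_subtype
  obtain ⟨e, he⟩ := exists_injective_nat s
  let ζ : ℕ → H := Function.extend e (fun α => ξ α) 0
  have hcomp : ∀ {E : Type _} [Zero E] (g : H → E), g 0 = 0 →
      (fun n => g (ζ n)) = Function.extend e (fun α : s => g (ξ α)) 0 := fun g hg => by
    funext n
    by_cases hn : ∃ α, e α = n
    · obtain ⟨α, rfl⟩ := hn
      simp only [ζ, he.extend_apply]
    · simp only [ζ, Function.extend_apply' _ _ _ hn, Pi.zero_apply, hg]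
  have hζ : Memℓp ζ 2 := by
    refine memℓp_gen ?_
    have : Summable fun n => ‖ζ n‖ ^ 2 := by
      rw [hcomp (fun v => ‖v‖ ^ 2) (by simp)]
      exact (((hasSum_extend_zero he).2 (hξ.subtype s).hasSum)).summable
    simpa using this
  refine ⟨⟨ζ, hζ⟩, fun x => ?_⟩
  have h1 : HasSum (fun n => ⟪ζ n, x (ζ n)⟫_ℂ) (normalFunctionalL ⟨ζ, hζ⟩ ⟨ζ, hζ⟩ x) :=
    (summable_normalFunctional ⟨ζ, hζ⟩ ⟨ζ, hζ⟩ x).hasSum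
  rw [hcomp (fun v => ⟪v, x v⟫_ℂ) (by simp), hasSum_extend_zero he] at h1
  refine (hasSum_subtype_iff_of_support_subset (s := s) fun α hα => ?_).1 h1
  rw [hs, Function.mem_support]
  intro h0
  have : ξ α = 0 := by simpa using h0
  exact hα (by simp [this])

theorem norm_sum_rankOne_le {w : Type*} {b : w → H} (hb : Orthonormal ℂ b) (s : Finset w) :
    ‖∑ α ∈ s, rankOne ℂ (b α) (b α)‖ ≤ 1 := by
  refine ContinuousLinearMap.opNorm_le_bound _ zero_le_one fun y => ?_
  rw [one_mul]
  refine le_of_sq_le_sq ?_ (norm_nonneg _)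
  refine le_trans (le_of_eq ?_) (hb.sum_inner_products_le (s := s) y)
  have e : (∑ α ∈ s, rankOne ℂ (b α) (b α)) y = ∑ α ∈ s, ⟪b α, y⟫_ℂ • b α := by
    simp
  rw [e, ← inner_self_eq_norm_sq (𝕜 := ℂ), hb.inner_sum, map_sum]
  refine Finset.sum_congr rfl fun α _ => ?_
  rw [RCLike.conj_mul]
  norm_cast

variable [CompleteSpace H]

open scoped ComplexOrder in
/-- A positive functional agrees on the operators of rank one with a normal functional. With `D` the
positive operator given by `⟪D k, h⟫ = ψ (rankOne h k)`, its square root `S` and a Hilbert basis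
`b`, the vectors `S (b α)` are square-summable, because `∑ ‖S (b α)‖²` is the trace of `D`. -/
theorem exists_normal_of_positive (ψ : StrongDual ℂ (H →L[ℂ] H)) (hψ : ∀ x, 0 ≤ x → 0 ≤ ψ x) :
    ∃ ζ : lp (fun _ : ℕ => H) 2, ∀ h k : H,
      ψ (rankOne ℂ h k) = normalFunctionalL ζ ζ (rankOne ℂ h k) := by
  let D : H →L[ℂ] H := InnerProductSpace.continuousLinearMapOfBilin
    ((ContinuousLinearMap.compL ℂ H (H →L[ℂ] H) ℂ ψ).comp (rankOne ℂ (E := H) (F := H)).flip)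
  have hD : ∀ h k : H, ⟪D k, h⟫_ℂ = ψ (rankOne ℂ h k) := fun h k =>
    InnerProductSpace.continuousLinearMapOfBilin_apply _ _ _
  have hDpos : 0 ≤ D := by
    rw [ContinuousLinearMap.nonneg_iff_isPositive, ContinuousLinearMap.isPositive_iff_complex]
    intro k
    have h0 : 0 ≤ ⟪D k, k⟫_ℂ := by
      rw [hD]
      exact hψ _ ((ContinuousLinearMap.nonneg_iff_isPositive _).2
        (InnerProductSpace.isPositive_rankOne_self k))
    rw [Complex.nonneg_iff] at h0
    exact ⟨Complex.ext (Complex.ofReal_re _) ((Complex.ofReal_im _).trans h0.2), h0.1⟩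
  set S := CFC.sqrt D with hS
  have hSS : ∀ k, S (S k) = D k := fun k =>
    congrArg (fun X : H →L[ℂ] H => X k) (CFC.sqrt_mul_sqrt_self D hDpos)
  have hSsa : ∀ h k, ⟪S h, k⟫_ℂ = ⟪h, S k⟫_ℂ := fun h k => by
    have : IsSelfAdjoint S := IsSelfAdjoint.of_nonneg (CFC.sqrt_nonneg D)
    rw [ContinuousLinearMap.isSelfAdjoint_iff'] at this
    rw [← ContinuousLinearMap.adjoint_inner_right, this]
  obtain ⟨w, b, -⟩ := exists_hilbertBasis ℂ H
  have hsum : Summable fun α => ‖S (b α)‖ ^ 2 := by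
    refine summable_of_sum_le (c := ‖ψ‖) (fun _ => by positivity) fun s => ?_
    have e : ∀ α, ‖S (b α)‖ ^ 2 = (ψ (rankOne ℂ (b α) (b α))).re := fun α => by
      rw [← hD, ← hSS, hSsa]
      exact (inner_self_eq_norm_sq (𝕜 := ℂ) _).symm
    calc ∑ α ∈ s, ‖S (b α)‖ ^ 2 = (ψ (∑ α ∈ s, rankOne ℂ (b α) (b α))).re := by
          rw [map_sum, Complex.re_sum]; exact Finset.sum_congr rfl fun α _ => e α
      _ ≤ ‖ψ (∑ α ∈ s, rankOne ℂ (b α) (b α))‖ := Complex.re_le_norm _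
      _ ≤ ‖ψ‖ * 1 := ψ.le_opNorm_of_le (norm_sum_rankOne_le b.orthonormal s)
      _ = ‖ψ‖ := mul_one _
  obtain ⟨ζ, hζ⟩ := exists_hasSum_normalFunctionalL _ hsum
  refine ⟨ζ, fun h k => ?_⟩
  have h1 := b.hasSum_inner_mul_inner (S k) (S h)
  rw [← hSsa (S k) h, hSS, hD] at h1
  refine h1.unique ?_
  convert! hζ (rankOne ℂ h k) using 2 with α
  rw [InnerProductSpace.rankOne_apply, inner_smul_right, hSsa (b α) h, ← hSsa k (b α)]

end Normal

/-! ### Finite-rank projections -/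

section FiniteRank

open InnerProductSpace (rankOne)

variable {H : Type u} [NormedAddCommGroup H] [InnerProductSpace ℂ H]

/-- The orthogonal projection onto the span of a finite set of vectors. -/
def finsetProjection (F : Finset H) : H →L[ℂ] H :=
  (Submodule.span ℂ (F : Set H)).starProjection

theorem finsetProjection_of_mem {F : Finset H} {h : H} (hh : h ∈ F) : finsetProjection F h = h :=
  Submodule.starProjection_eq_self_iff.2 (Submodule.subset_span hh)

theorem norm_finsetProjection_apply_le (F : Finset H) (h : H) : ‖finsetProjection F h‖ ≤ ‖h‖ :=
  Submodule.norm_starProjection_apply_le _ _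

/-- The net is eventually constant at each vector. -/
theorem tendsto_finsetProjection (h : H) :
    Tendsto (fun F => finsetProjection F h) atTop (𝓝 h) := by
  classical
  refine tendsto_const_nhds.congr' ?_
  filter_upwards [eventually_ge_atTop ({h} : Finset H)] with F hF
  exact (finsetProjection_of_mem (hF (Finset.mem_singleton_self h))).symm

theorem inner_finsetProjection (F : Finset H) (h k : H) :
    ⟪h, finsetProjection F k⟫_ℂ = ⟪finsetProjection F h, k⟫_ℂ :=
  (Submodule.inner_starProjection_left_eq_right _ h k).symm

theorem isCompactOperator_finsetProjection (F : Finset H) :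
    IsCompactOperator (finsetProjection F) := by
  have : ProperSpace (Submodule.span ℂ (F : Set H)) := FiniteDimensional.proper ℂ _
  have h : IsCompactOperator (Submodule.span ℂ (F : Set H)).orthogonalProjectionOnto :=
    isCompactOperator_of_locallyCompactSpace_dom _
  exact h.clm_comp (Submodule.subtypeL _)

theorem exists_finsetProjection_eq_sum (F : Finset H) :
    ∃ (n : ℕ) (b : Fin n → H), finsetProjection F = ∑ i, rankOne ℂ (b i) (b i) :=
  ⟨_, _, (stdOrthonormalBasis ℂ (Submodule.span ℂ (F : Set H))).starProjection_eq_sum_rankOne⟩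

theorem tendsto_normalFunctionalL_mul (ξ η : lp (fun _ : ℕ => H) 2) (x : H →L[ℂ] H) :
    Tendsto (fun F => normalFunctionalL ξ η (x * finsetProjection F)) atTop
      (𝓝 (normalFunctionalL ξ η x)) := by
  refine tendsto_tsum_of_dominated_convergence (bound := fun n => ‖x‖ * (‖η n‖ * ‖ξ n‖))
    ((summable_norm_mul_norm ξ η).mul_left _) (fun n => ?_) (Eventually.of_forall fun F n => ?_)
  · exact ((innerSL ℂ (η n)).continuous.tendsto _).comp
      ((x.continuous.tendsto _).comp (tendsto_finsetProjection (ξ n)))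
  · calc ‖⟪η n, x (finsetProjection F (ξ n))⟫_ℂ‖ ≤ ‖η n‖ * ‖x (finsetProjection F (ξ n))‖ :=
          norm_inner_le_norm _ _
      _ ≤ ‖η n‖ * (‖x‖ * ‖ξ n‖) := by
          gcongr
          exact x.le_opNorm_of_le (norm_finsetProjection_apply_le F _)
      _ = ‖x‖ * (‖η n‖ * ‖ξ n‖) := by ring

theorem tendsto_ultraweak_mul_finsetProjection (x : H →L[ℂ] H) :
    Tendsto (fun F => x * finsetProjection F) atTop (@nhds _ (ultraweakTopology H) x) := by
  rw [nhds_iInf, tendsto_iInf]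
  rintro ⟨ξ, η⟩
  rw [nhds_induced, tendsto_comap_iff]
  exact tendsto_normalFunctionalL_mul ξ η x

/-- Multiplying a normal functional by the finite-rank projections approximates it in norm. -/
theorem tendsto_dualMul_normalFunctionalL (ξ η : lp (fun _ : ℕ => H) 2) :
    Tendsto (fun F => dualMul (normalFunctionalL ξ η) (finsetProjection F)) atTop
      (𝓝 (normalFunctionalL ξ η)) := by
  rw [tendsto_iff_norm_sub_tendsto_zero]
  have h0 : Tendsto (fun F : Finset H => ∑' n, ‖finsetProjection F (η n) - η n‖ * ‖ξ n‖) atTop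
      (𝓝 (∑' _ : ℕ, 0)) := by
    refine tendsto_tsum_of_dominated_convergence (bound := fun n => 2 * (‖η n‖ * ‖ξ n‖))
      ((summable_norm_mul_norm ξ η).mul_left _) (fun n => ?_) (Eventually.of_forall fun F n => ?_)
    · have := ((tendsto_finsetProjection (η n)).sub_const (η n)).norm.mul_const ‖ξ n‖
      simpa using this
    · rw [norm_mul, norm_norm, norm_norm, ← mul_assoc]
      gcongr
      calc _ ≤ ‖finsetProjection F (η n)‖ + ‖η n‖ := norm_sub_le _ _
        _ ≤ 2 * ‖η n‖ := by linarith [norm_finsetProjection_apply_le F (η n)]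
  rw [tsum_zero] at h0
  refine squeeze_zero (fun _ => norm_nonneg _) (fun F => ?_) h0
  have hsum : Summable fun n => ‖finsetProjection F (η n) - η n‖ * ‖ξ n‖ := by
    refine .of_nonneg_of_le (fun _ => by positivity) (fun n => ?_)
      ((summable_norm_mul_norm ξ η).mul_left 2)
    rw [← mul_assoc]
    gcongr
    calc _ ≤ ‖finsetProjection F (η n)‖ + ‖η n‖ := norm_sub_le _ _
      _ ≤ 2 * ‖η n‖ := by linarith [norm_finsetProjection_apply_le F (η n)]
  refine ContinuousLinearMap.opNorm_le_bound _ (tsum_nonneg fun _ => by positivity) fun x => ?_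
  have e : (dualMul (normalFunctionalL ξ η) (finsetProjection F) - normalFunctionalL ξ η) x =
      ∑' n, ⟪finsetProjection F (η n) - η n, x (ξ n)⟫_ℂ := by
    rw [sub_apply, dualMul_apply, normalFunctionalL_apply, normalFunctionalL_apply,
      ← (summable_normalFunctional ξ η (finsetProjection F * x)).tsum_sub
        (summable_normalFunctional ξ η x)]
    refine tsum_congr fun n => ?_
    rw [inner_sub_left, ← inner_finsetProjection]
    rfl
  rw [e, ← tsum_mul_right]
  refine tsum_of_norm_bounded (hsum.mul_right _).hasSum fun n => ?_
  calc _ ≤ ‖finsetProjection F (η n) - η n‖ * ‖x (ξ n)‖ := norm_inner_le_norm _ _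
    _ ≤ ‖finsetProjection F (η n) - η n‖ * (‖x‖ * ‖ξ n‖) := by gcongr; exact x.le_opNorm _
    _ = _ := by ring

theorem apply_mul_finsetProjection_eq {Φ ω : StrongDual ℂ (H →L[ℂ] H)}
    (h : ∀ h k : H, Φ (rankOne ℂ h k) = ω (rankOne ℂ h k)) (x : H →L[ℂ] H) (F : Finset H) :
    Φ (x * finsetProjection F) = ω (x * finsetProjection F) := by
  obtain ⟨n, b, hb⟩ := exists_finsetProjection_eq_sum F
  rw [hb, Finset.mul_sum, map_sum, map_sum]
  refine Finset.sum_congr rfl fun i _ => ?_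
  rw [ContinuousLinearMap.mul_def, InnerProductSpace.comp_rankOne, h]

variable [CompleteSpace H]

theorem finsetProjection_nonneg (F : Finset H) : 0 ≤ finsetProjection F :=
  IsStarProjection.nonneg isStarProjection_starProjection

/-- Every functional on `B(H)` has a normal part: a normal functional with the same restriction to
the operators of finite rank. -/
theorem exists_normal_part (Φ : StrongDual ℂ (H →L[ℂ] H)) :
    ∃ ω : StrongDual ℂ (H →L[ℂ] H), Continuous[ultraweakTopology H, inferInstance] ω ∧
      Tendsto (fun F => dualMul ω (finsetProjection F)) atTop (𝓝 ω) ∧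
      ∀ h k : H, Φ (rankOne ℂ h k) = ω (rankOne ℂ h k) := by
  refine dual_induction (B := H →L[ℂ] H) (P := fun Φ => ∃ ω : StrongDual ℂ (H →L[ℂ] H),
      Continuous[ultraweakTopology H, inferInstance] ω ∧
      Tendsto (fun F => dualMul ω (finsetProjection F)) atTop (𝓝 ω) ∧
      ∀ h k : H, Φ (rankOne ℂ h k) = ω (rankOne ℂ h k)) ?_ ?_ ?_ Φ
  · rintro φ ψ ⟨ω₁, c1, t1, e1⟩ ⟨ω₂, c2, t2, e2⟩
    have add : ∀ {X : Type u} (τ : TopologicalSpace X) (f g : X → ℂ), Continuous f →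
        Continuous g → Continuous (f + g) := fun τ f g hf hg => hf.add hg
    refine ⟨ω₁ + ω₂, add (ultraweakTopology H) ω₁ ω₂ c1 c2, ?_, fun h k => ?_⟩
    · exact (t1.add t2).congr fun F => ContinuousLinearMap.ext fun x => rfl
    · rw [add_apply, add_apply, e1, e2]
  · rintro c φ ⟨ω, c1, t1, e1⟩
    have smul : ∀ {X : Type u} (τ : TopologicalSpace X) (f : X → ℂ), Continuous f →
        Continuous (c • f) := fun τ f hf => hf.const_smul c
    refine ⟨c • ω, smul (ultraweakTopology H) ω c1, ?_, fun h k => ?_⟩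
    · exact (t1.const_smul c).congr fun F => ContinuousLinearMap.ext fun x => rfl
    · rw [smul_apply, smul_apply, e1]
  · intro ψ hψ
    obtain ⟨ζ, hζ⟩ := exists_normal_of_positive ψ hψ
    exact ⟨normalFunctionalL ζ ζ, continuous_normalFunctionalL ζ ζ,
      tendsto_dualMul_normalFunctionalL ζ ζ, hζ⟩

theorem apply_finsetProjection_mul_eq {Φ ω : StrongDual ℂ (H →L[ℂ] H)}
    (h : ∀ h k : H, Φ (rankOne ℂ h k) = ω (rankOne ℂ h k)) (x : H →L[ℂ] H) (F : Finset H) :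
    Φ (finsetProjection F * x) = ω (finsetProjection F * x) := by
  obtain ⟨n, b, hb⟩ := exists_finsetProjection_eq_sum F
  rw [hb, Finset.sum_mul, map_sum, map_sum]
  refine Finset.sum_congr rfl fun i _ => ?_
  rw [ContinuousLinearMap.mul_def, InnerProductSpace.rankOne_comp, h]

end FiniteRank

/-! ### The Lebesgue projection of an algebra containing the compact operators -/

section Compact

variable {H : Type u} [NormedAddCommGroup H] [InnerProductSpace ℂ H] [CompleteSpace H]
  {T : StarSubalgebra ℂ (H →L[ℂ] H)}

/-- The finite-rank projections as elements of an algebra that contains the compact operators. -/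
def finsetProjectionMem (hT : ∀ x : H →L[ℂ] H, IsCompactOperator x → x ∈ T) (F : Finset H) : T :=
  ⟨finsetProjection F, hT _ (isCompactOperator_finsetProjection F)⟩

variable (T) in
/-- Restriction of functionals from `B(H)` to `T`. -/
def dualRestrict : StrongDual ℂ (H →L[ℂ] H) →L[ℂ] StrongDual ℂ T :=
  (ContinuousLinearMap.compL ℂ T (H →L[ℂ] H) ℂ).flip
    (Subalgebra.toSubmodule T.toSubalgebra).subtypeL

theorem dualRestrict_apply (Φ : StrongDual ℂ (H →L[ℂ] H)) (x : T) : dualRestrict T Φ x = Φ x := rfl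

theorem isAbsCont_dualRestrict {ω : StrongDual ℂ (H →L[ℂ] H)}
    (hω : Continuous[ultraweakTopology H, inferInstance] ω) :
    IsAbsCont (allBounded H) T (dualRestrict T ω) := by
  refine ⟨ω.toLinearMap ∘ₗ (allBounded H).toStarSubalgebra.subtype.toLinearMap, ?_, ?_⟩
  · exact @Continuous.comp _ _ _ (weakStarTopology (allBounded H)) (ultraweakTopology H) _ _ _ hω
      (@continuous_induced_dom _ _ _ (ultraweakTopology H))
  · rintro x w hw
    rw [dualRestrict_apply, ← hw]
    rfl

/-- An absolutely continuous functional is determined by its values on finite-rank operators. -/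
theorem tendsto_apply_mul_of_isAbsCont (hT : ∀ x : H →L[ℂ] H, IsCompactOperator x → x ∈ T)
    {ψ : StrongDual ℂ T} (hψ : IsAbsCont (allBounded H) T ψ) (x : T) :
    Tendsto (fun F => ψ (x * finsetProjectionMem hT F)) atTop (𝓝 (ψ x)) := by
  obtain ⟨Φ, hΦ, h⟩ := hψ
  let j : (H →L[ℂ] H) → (allBounded H).toStarSubalgebra := fun y => ⟨y, trivial⟩
  have e : ∀ y : T, Φ (j y) = ψ y := fun y => h y _ rfl
  have h1 : Tendsto (fun F => j ((x : H →L[ℂ] H) * finsetProjection F)) atTop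
      (@nhds _ (weakStarTopology (allBounded H)) (j x)) := by
    rw [@nhds_induced _ _ (ultraweakTopology H), tendsto_comap_iff]
    exact tendsto_ultraweak_mul_finsetProjection (x : H →L[ℂ] H)
  have h2 := (@Continuous.tendsto _ _ (weakStarTopology (allBounded H)) _ _ hΦ (j x)).comp h1
  rw [e] at h2
  exact h2.congr fun F => e (x * finsetProjectionMem hT F)

/-- The functionals `x ↦ φ (x e)` converge pointwise, and `x ↦ φ (e x)` in norm, along the
finite-rank projections `e`, to the normal part `ω` of an extension of `φ` to `B(H)`. -/
theorem exists_normal_part_of_compact_mem (hT : ∀ x : H →L[ℂ] H, IsCompactOperator x → x ∈ T)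
    (φ : StrongDual ℂ T) :
    ∃ ω : StrongDual ℂ (H →L[ℂ] H), Continuous[ultraweakTopology H, inferInstance] ω ∧
      (∀ x : T, Tendsto (fun F => φ (x * finsetProjectionMem hT F)) atTop (𝓝 (ω x))) ∧
      Tendsto (fun F => dualMul φ (finsetProjectionMem hT F)) atTop (𝓝 (dualRestrict T ω)) := by
  obtain ⟨Φ, hΦ, -⟩ := exists_extension_dual T φ
  obtain ⟨ω, hc, ht, he⟩ := exists_normal_part Φ
  refine ⟨ω, hc, fun x => ?_, ?_⟩
  · refine (tendsto_apply_mul_of_isAbsCont hT (isAbsCont_dualRestrict hc) x).congr fun F => ?_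
    rw [dualRestrict_apply, ← hΦ]
    exact (apply_mul_finsetProjection_eq he x F).symm
  · refine (((dualRestrict T).continuous.tendsto _).comp ht).congr fun F => ?_
    ext x
    rw [dualMul_apply, ← hΦ]
    exact (apply_finsetProjection_mul_eq he x F).symm

/-- The Lebesgue projection is the weak-star limit of the finite-rank projections. It is central
because `φ e` converges in norm to `z φ` along them, by their action on the normal part of `φ`. -/
theorem exists_lebesgueProjection (hT : ∀ x : H →L[ℂ] H, IsCompactOperator x → x ∈ T) :
    ∃ z : StrongDual ℂ (StrongDual ℂ T), IsLebesgueProjection (allBounded H) T z ∧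
      IsOpenProjection T z ∧
      ∀ φ, Tendsto (fun F => φ (finsetProjectionMem hT F)) atTop (𝓝 (z φ)) := by
  classical
  choose ω hc hr hl using exists_normal_part_of_compact_mem hT
  set e := finsetProjectionMem hT with he
  have hnorm : ∀ F, ‖e F‖ ≤ 1 := fun F =>
    Submodule.starProjection_norm_le (Submodule.span ℂ (F : Set H))
  have hlim : ∀ φ : StrongDual ℂ T, Tendsto (fun F => φ (e F)) atTop (𝓝 (ω φ 1)) := fun φ => by
    simpa using hr φ 1
  let z₀ : StrongDual ℂ T →ₗ[ℂ] ℂ := linearMapOfTendsto (fun φ => ω φ 1)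
    (fun F => (NormedSpace.inclusionInDoubleDual ℂ T (e F)).toLinearMap)
    (tendsto_pi_nhds.2 hlim)
  let z : StrongDual ℂ (StrongDual ℂ T) := z₀.mkContinuous 1 fun φ => by
    refine le_of_tendsto (hlim φ).norm (Eventually.of_forall fun F => ?_)
    rw [mul_comm]
    exact φ.le_opNorm_of_le (hnorm F)
  have hz : ∀ φ, Tendsto (fun F => φ (e F)) atTop (𝓝 (z φ)) := hlim
  have hzφ : ∀ φ, bidualSMul z φ = dualRestrict T (ω φ) := fun φ => by
    ext x
    exact tendsto_nhds_unique (hz (dualMul φ x)) (hr φ x)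
  have hac : ∀ ψ, IsAbsCont (allBounded H) T ψ → bidualSMul z ψ = ψ := fun ψ hψ => by
    ext x
    exact tendsto_nhds_unique (hz (dualMul ψ x)) (tendsto_apply_mul_of_isAbsCont hT hψ x)
  have hzac : ∀ φ, IsAbsCont (allBounded H) T (bidualSMul z φ) := fun φ => by
    rw [hzφ]; exact isAbsCont_dualRestrict (hc φ)
  have hproj : IsBidualProjection z := by
    constructor
    · ext φ
      rw [arens_apply, ← bidualSMul_apply_one, hac _ (hzac φ), bidualSMul_apply_one]
    · intro φ
      refine tendsto_nhds_unique ((continuous_star.tendsto _).comp (hz (dualStar φ))) ?_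
      refine (hz φ).congr fun F => ?_
      have : star (e F) = e F := Subtype.ext (IsSelfAdjoint.of_nonneg (finsetProjection_nonneg F))
      rw [Function.comp_apply, dualStar_apply, star_star, this]
  refine ⟨z, ⟨hproj, fun Λ => ?_, Set.Subset.antisymm (fun ψ hψ => ⟨ψ, hac ψ hψ⟩) ?_⟩,
    ⟨hproj, Finset H, inferInstance, inferInstance, inferInstance, e, fun F G hFG => ?_,
      fun F => ⟨finsetProjection_nonneg F, hnorm F⟩, hz⟩, hz⟩
  · ext φ
    refine tendsto_nhds_unique (hz (bidualSMul Λ φ)) ?_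
    rw [arens_apply, hzφ]
    exact (Λ.continuous.tendsto _).comp (hl φ)
  · rintro _ ⟨φ, rfl⟩
    exact hzac φ
  · exact Submodule.starProjection_le_starProjection_iff.2 (Submodule.span_mono hFG)

/-- In infinite dimensions the identity is not in the closed subspace of compact operators. -/
theorem exists_dual_vanishing_on_compact (hH : ¬ FiniteDimensional ℂ H) :
    ∃ φ : StrongDual ℂ (H →L[ℂ] H), φ 1 ≠ 0 ∧ ∀ x : H →L[ℂ] H, IsCompactOperator x → φ x = 0 := by
  let K : Submodule ℂ (H →L[ℂ] H) := compactOperator (RingHom.id ℂ) H H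
  have hK : IsClosed (K : Set (H →L[ℂ] H)) := isClosed_setOfPred_isCompactOperator
  have h1 : K.mkQ 1 ≠ 0 := by
    rw [Submodule.mkQ_apply, Ne, Submodule.Quotient.mk_eq_zero]
    intro h
    exact hH (FiniteDimensional.of_isCompactOperator_id (𝕜 := ℂ) h)
  have := hK
  obtain ⟨f, hf⟩ := SeparatingDual.exists_ne_zero (R := ℂ) h1
  refine ⟨f.comp K.mkQL, hf, fun x hx => ?_⟩
  have : K.mkQL x = 0 := (Submodule.Quotient.mk_eq_zero K).2 hx
  rw [ContinuousLinearMap.comp_apply, this, map_zero]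

end Compact

end

theorem theoremT {H : Type u} [NormedAddCommGroup H] [InnerProductSpace ℂ H] [CompleteSpace H] :
    (∀ (W : VonNeumannAlgebra H) (T : StarSubalgebra ℂ (H →L[ℂ] H))
      (A : Subalgebra ℂ (H →L[ℂ] H)),
      IsClosed (T : Set (H →L[ℂ] H)) → T ≤ W.toStarSubalgebra →
      ∀ (hAT : A ≤ T.toSubalgebra) (z : StrongDual ℂ (StrongDual ℂ T)),
        IsLebesgueProjection W T z → IsOpenProjection T z → HasGleasonWhitney W hAT →
        ∀ χ : StrongDual ℂ A, IsCharacter χ → IsAbsCont W A χ →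
          ∃ p : StrongDual ℂ (StrongDual ℂ A), p ≠ 0 ∧
            IsBidualProjection (bidualIncl hAT p) ∧
            BidualProjectionLE (bidualIncl hAT p) z ∧ p χ = 1) ∧
    (∀ T : StarSubalgebra ℂ (H →L[ℂ] H), IsClosed (T : Set (H →L[ℂ] H)) →
      (∀ x : H →L[ℂ] H, IsCompactOperator x → x ∈ T) →
      ∃ z : StrongDual ℂ (StrongDual ℂ T),
        IsLebesgueProjection (allBounded H) T z ∧ IsOpenProjection T z ∧
        (¬ FiniteDimensional ℂ H →
          z ≠ 0 ∧ z ≠ bidualOne ∧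
          ∀ (A : Subalgebra ℂ (H →L[ℂ] H)) (hAT : A ≤ T.toSubalgebra),
            HasGleasonWhitney (allBounded H) hAT →
            ∀ χ : StrongDual ℂ A, IsCharacter χ → IsAbsCont (allBounded H) A χ →
              ∃ p : StrongDual ℂ (StrongDual ℂ A), p ≠ 0 ∧ p ≠ bidualOne ∧
                IsBidualProjection (bidualIncl hAT p) ∧
                BidualProjectionLE (bidualIncl hAT p) z ∧ p χ = 1)) := by
  refine ⟨fun W T A _ _ hAT z hz hzo hGW χ hχ hχac =>
    exists_projection_le W hAT z hz hzo hGW χ hχ hχac, fun T _ hT => ?_⟩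
  obtain ⟨z, hz, hzo, hlim⟩ := exists_lebesgueProjection hT
  refine ⟨z, hz, hzo, fun hH => ?_⟩
  have hz1 : z ≠ bidualOne := fun h => by
    obtain ⟨φ, hφ1, hφ⟩ := exists_dual_vanishing_on_compact hH
    have h0 : Tendsto (fun F => dualRestrict T φ (finsetProjectionMem hT F)) atTop (𝓝 0) :=
      tendsto_const_nhds.congr fun F => (hφ _ (isCompactOperator_finsetProjection F)).symm
    have h1 := tendsto_nhds_unique h0 (hlim (dualRestrict T φ))
    rw [h] at h1
    exact hφ1 h1.symm
  refine ⟨fun h => ?_, hz1, fun A hAT hGW χ hχ hχac => ?_⟩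
  · have : Nontrivial H := not_subsingleton_iff_nontrivial.1 fun _ => hH inferInstance
    obtain ⟨v, hv⟩ := exists_ne (0 : H)
    have h1 := hlim (dualRestrict T ((innerSL ℂ v).comp (ContinuousLinearMap.apply ℂ H v)))
    have h2 : Tendsto (fun F => ⟪v, finsetProjection F v⟫_ℂ) atTop (𝓝 ⟪v, v⟫_ℂ) :=
      ((innerSL ℂ v).continuous.tendsto _).comp (tendsto_finsetProjection v)
    rw [h] at h1
    exact hv (inner_self_eq_zero.1 (tendsto_nhds_unique h2 h1))
  · obtain ⟨p, hp0, hp, hpz, hpχ⟩ := exists_projection_le _ hAT z hz hzo hGW χ hχ hχac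
    refine ⟨p, hp0, fun h => hz1 ?_, hp, hpz, hpχ⟩
    -- if `p` is the identity, then so is `z`, since `p z = p`
    have h1 := hpz.1
    rw [h, bidualIncl_one, bidualOne_arens] at h1
    exact h1
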